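/- Let $\lambda_a,\lambda_u,P_u>0$ and $\alpha_u>2$, and let the access points (APs) form a homogeneous Poisson point process $\Phi_a$ of density $\lambda_a$ in $\mathbb R^2$. Let $x^*$ be the point of $\Phi_a$ closest to the origin $o$ (the case of a typical node that is not an AP); in the case of a typical node that is an AP, $\Phi_a$ is instead conditioned, in the sense of the Palm distribution, to have a point at $o$, and $x^*=o$. Let $$\mathcal V^*=\{y\in\mathbb R^2: |y-x^*|<|y-x| \text{ for all } x\in\Phi_a\setminus\{x^*\}\}$$ be the Voronoi cell of $x^*$. Let the UEs form a homogeneous Poisson point process $\Phi_u$ of density $\lambda_u$ independent of $\Phi_a$, with channel gains $(g_x)_{x\in\Phi_u}$ that are i.i.d. exponential of mean $1$ and independent of all positions. Let $x_R\in\mathbb R^2$ be a receiver position, which may be any point or depend measurably on $x^*$ (for example $x_R=x^*$), and let $$I_{x_R,u}=\sum_{x\in\Phi_u\setminus\mathcal V^*}P_u\,g_x\,|x-x_R|^{-\alpha_u}.$$ The sum converges almost surely. Let $p_c(x\mid x^*)=\mathbb P(x\in\mathcal V^*\mid x^*)$; for every $x\in\mathbb R^2$ it equals $e^{-\lambda_a|\mathcal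 A|}$, where $\mathcal A=\mathcal B(x,|x-x^*|)\setminus\mathcal B(o,|x^*|)$, $\mathcal B(y,R)$ is the open disc of centre $y$ and radius $R$, and $|\mathcal A|$ is the area of $\mathcal A$. Then for every $s\ge 0$, almost surely (and, when $x^*=o$, under the Palm distribution), $$\mathbb E\bigl(e^{-sI_{x_R,u}}\mid x^*\bigr)\;\ge\;\exp\Bigl\{-2\pi\int_0^\infty \lambda_{x_R,u}(r)\,r\,\gamma\bigl(sP_u r^{-\alpha_u}\bigr)\,dr\Bigr\},\qquad \gamma(t)=1-\frac1{1+t},$$ where, with $(r,\theta)$ denoting the point with polar coordinates $r$ and $\theta$, $$\lambda_{x_R,u}(r)=\lambda_u\Bigl(1-\frac1{2\pi}\int_0^{2\pi}p_c\bigl((r,\theta)+x_R\mid x^*\bigr)\,d\theta\Bigr).$$ -/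

import Mathlib

open MeasureTheory ProbabilityTheory

noncomputable section

namespace CellularInterference

/-- The Euclidean plane. -/
abbrev Plane : Type := EuclideanSpace ℝ (Fin 2)

/-- The `σ`-algebra on configurations (subsets of the plane) generated by the numbers of points
in the Borel sets. -/
abbrev configSigma : MeasurableSpace (Set Plane) :=
  ⨆ (B : Set Plane) (_ : MeasurableSet B),
    MeasurableSpace.comap (fun S : Set Plane => (S ∩ B).encard) inferInstance

/-- `Φ` is a homogeneous Poisson point process of density `lam` in the plane: the number of points
in a Borel set of finite area is Poisson distributed with mean `lam` times the area, and the
numbers of points in pairwise disjoint Borel sets are independent. -/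
structure IsHPPP {Ω : Type*} [MeasurableSpace Ω] (P : Measure Ω) (lam : ℝ)
    (Φ : Ω → Set Plane) : Prop where
  measurable_count : ∀ B : Set Plane, MeasurableSet B → Measurable fun ω => (Φ ω ∩ B).encard
  law_count : ∀ B : Set Plane, MeasurableSet B → volume B < ⊤ →
    P.map (fun ω => (Φ ω ∩ B).encard) =
      (poissonMeasure (lam * (volume B).toReal).toNNReal).map (fun k : ℕ => (k : ℕ∞))
  indep_count : ∀ (n : ℕ) (B : Fin n → Set Plane), (∀ i, MeasurableSet (B i)) →
    Pairwise (fun i j => Disjoint (B i) (B j)) →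
    iIndepFun (fun i ω => (Φ ω ∩ B i).encard) P

/-- The random configuration `Φ₀` follows the Palm distribution (at the origin) of the stationary
point process `Φ` of density `lam`: for every event `Γ` and every Borel set `B` of finite area,
the expected number of points `x` of `Φ` in `B` such that `Φ`, seen from `x`, belongs to `Γ` is
`lam * |B| * P₀ (Φ₀ ∈ Γ)`. This is the meaning of "`Φ` given that there is a point at the
origin". -/
structure HasPalmLaw {Ω Ω₀ : Type*} [MeasurableSpace Ω] [MeasurableSpace Ω₀]
    (P : Measure Ω) (lam : ℝ) (Φ : Ω → Set Plane) (P₀ : Measure Ω₀) (Φ₀ : Ω₀ → Set Plane) :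
    Prop where
  measurable : Measurable[_, configSigma] Φ₀
  palm : ∀ Γ : Set (Set Plane), MeasurableSet[configSigma] Γ →
    ∀ B : Set Plane, MeasurableSet B → volume B < ⊤ →
      ∫⁻ ω, ∑' x : ↥(Φ ω ∩ B), Γ.indicator (fun _ => (1 : ENNReal))
          ((fun y => y - (x : Plane)) '' Φ ω) ∂P
        = ENNReal.ofReal lam * volume B * P₀ (Φ₀ ⁻¹' Γ)

/-- The UEs: their positions `U 0, U 1, …` enumerate a homogeneous Poisson point process of density
`lamU` that is independent of the random set `Φa` of APs, and their channel gains
`g 0, g 1, …` are i.i.d. exponential of mean `1`, independent of all positions. -/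
structure IsUELayer {Ω : Type*} [MeasurableSpace Ω] (P : Measure Ω) (Φa : Ω → Set Plane)
    (lamU : ℝ) (U : ℕ → Ω → Plane) (g : ℕ → Ω → ℝ) : Prop where
  measurable_position : ∀ n, Measurable (U n)
  distinct : ∀ᵐ ω ∂P, Function.Injective fun n => U n ω
  poisson : IsHPPP P lamU fun ω => Set.range fun n => U n ω
  indep_position : Indep (MeasurableSpace.comap Φa configSigma)
    (⨆ n, MeasurableSpace.comap (U n) inferInstance) P
  measurable_gain : ∀ n, Measurable (g n)
  law_gain : ∀ n, P.map (g n) = expMeasure 1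
  indep_gain : iIndepFun g P
  indep_gain_position : Indep (⨆ n, MeasurableSpace.comap (g n) inferInstance)
    (MeasurableSpace.comap Φa configSigma ⊔ ⨆ n, MeasurableSpace.comap (U n) inferInstance) P

/-- The (open) Voronoi cell of the point `c` of the configuration `S`. -/
def voronoiCell (S : Set Plane) (c : Plane) : Set Plane :=
  {y | ∀ x ∈ S \ {c}, ‖y - c‖ < ‖y - x‖}

/-- `c` is a point of the configuration `S` that is closest to the origin. -/
def IsNearest (S : Set Plane) (c : Plane) : Prop :=
  c ∈ S ∧ ∀ x ∈ S, ‖c‖ ≤ ‖x‖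

/-- The interference power received at `xR` from the `n`-th UE, which has position `u n` and channel
gain `h n`; the UEs in the guard region `V` do not transmit. -/
def interferenceTerm (Pu α : ℝ) (V : Set Plane) (u : ℕ → Plane) (h : ℕ → ℝ) (xR : Plane)
    (n : ℕ) : ℝ :=
  Vᶜ.indicator (fun x => Pu * h n * ‖x - xR‖ ^ (-α)) (u n)

/-- The total interference power received at `xR` from the UEs outside the guard region `V`. -/
def interference (Pu α : ℝ) (V : Set Plane) (u : ℕ → Plane) (h : ℕ → ℝ) (xR : Plane) : ℝ :=
  ∑' n, interferenceTerm Pu α V u h xR n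

/-- The explicit probabilistic cell area function `p_c(x | c)`:
`exp (- lamA * |B(x, |x - c|) \ B(o, |c|)|)`. -/
def pca (lamA : ℝ) (x c : Plane) : ℝ :=
  Real.exp (-lamA * (volume (Metric.ball x ‖x - c‖ \ Metric.ball 0 ‖c‖)).toReal)

/-- The point with polar coordinates `(r, θ)`. -/
def polarPoint (r θ : ℝ) : Plane := !₂[r * Real.cos θ, r * Real.sin θ]

/-- The equivalent radial density `λ_{xR,u}(r)`, given that the nearest AP is at `c`. -/
def equivDensity (lamA lamU : ℝ) (xR c : Plane) (r : ℝ) : ℝ :=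
  lamU * (1 - 1 / (2 * Real.pi) *
    ∫ θ in (0 : ℝ)..(2 * Real.pi), pca lamA (polarPoint r θ + xR) c)

/-- `γ(t) = 1 - 1 / (1 + t)`. -/
def gammaFun (t : ℝ) : ℝ := 1 - 1 / (1 + t)

/-- The radial formula for the Laplace transform of the interference created by Poisson interferers
of radial density `dens`. -/
def radialLaplace (Pw α : ℝ) (dens : ℝ → ℝ) (s : ℝ) : ℝ :=
  Real.exp (-(2 * Real.pi) *
    ∫ r in Set.Ioi (0 : ℝ), dens r * r * gammaFun (s * Pw * r ^ (-α)))

end CellularInterference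

end

open scoped ENNReal NNReal

noncomputable section
namespace CellularInterference

open Filter Topology TopologicalSpace

/-! Given all the APs, hence the cell V, the active UEs form a Poisson process on the complement of
V with independent exponential gains. The Laplace transform of the interference given the APs is
therefore exp(-λ_u X), where X is the integral of γ(s P_u |y - x_R|^(-α)) over the complement of V.
If only x* is given, Fubini's theorem shows that X has conditional mean Y, the integral over the
plane of (1 - p_c(y | x*)) γ(s P_u |y - x_R|^(-α)). Jensen's inequality gives E(exp(-λ_u X) | x*) ≥
exp(-λ_u Y), and polar coordinates around x_R turn the right side into the radial formula
(`radialLaplace_eq`).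

The formula for p_c rests on a Campbell formula, `lintegral_tsum_isolatedPoints`: the expected
number of points c in B with no other point in a void {φ c ≤ 0} is the integral over B of λ exp(-λ
|void|). It is proved by a fine grid and the independence of counts. If the void is the union of two
discs through c, centred at the origin and at x, this is the joint law of x* and the event x ∈ V
(`IsHPPP.measure_voronoi`). If the void is one disc translated along with c, it is the Palm case
(`HasPalmLaw.measure_voronoi`).

Since an inequality is wanted, only a lower bound for the Laplace functional of the UEs is needed:
`exp_le_lintegral_interference` rounds the test function down to a step function, uses independent
Poisson counts, and passes to the limit. The Fubini step is `lintegral_voronoi_compl`, and it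
requires `regularVoronoi`, a version of the cell that is jointly measurable in the configuration and
the point. Jensen's inequality is used integrated over events of σ(x*) (`setLIntegral_exp_le`), and
`le_condExp_of_setLIntegral_le` converts the result into a bound on the conditional expectation. -/

/-- Configurations of points of the plane, as a measurable space. -/
def Config : Type := Set Plane

instance : MeasurableSpace Config := configSigma

/-! ### Measurability of configurations and Poisson counts. -/

theorem measurable_encard_inter {B : Set Plane} (hB : MeasurableSet B) :
    Measurable fun S : Config => (Set.encard ((S : Set Plane) ∩ B)) := by
  rw [measurable_iff_comap_le]
  exact le_iSup₂ (f := fun (B : Set Plane) (_ : MeasurableSet B) =>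
    MeasurableSpace.comap (fun S : Set Plane => (S ∩ B).encard) inferInstance) B hB

theorem measurable_config {Ω : Type*} [MeasurableSpace Ω] {Φ : Ω → Set Plane}
    (h : ∀ B : Set Plane, MeasurableSet B → Measurable fun ω => (Φ ω ∩ B).encard) :
    Measurable (β := Config) Φ := by
  refine measurable_iff_le_map.2 ?_
  change configSigma ≤ MeasurableSpace.map Φ inferInstance
  refine iSup₂_le fun B hB => ?_
  rw [MeasurableSpace.comap_le_iff_le_map]
  exact measurable_iff_le_map.1 (h B hB)

/-- Measures on the plane that agree on the Borel sets of finite area are equal. -/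
theorem measure_ext_of_volume_lt_top {μ ν : Measure Plane}
    (h : ∀ B : Set Plane, MeasurableSet B → volume B < ⊤ → μ B = ν B) : μ = ν := by
  ext A hA
  have hmono : Monotone fun n : ℕ => A ∩ Metric.ball (0 : Plane) n := fun m n hmn =>
    Set.inter_subset_inter_right _ (Metric.ball_subset_ball (by exact_mod_cast hmn))
  have hU : A = ⋃ n : ℕ, A ∩ Metric.ball (0 : Plane) n := by
    rw [← Set.inter_iUnion, Metric.iUnion_ball_nat, Set.inter_univ]
  rw [hU, hmono.measure_iUnion, hmono.measure_iUnion]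
  congr 1
  ext n
  exact h _ (hA.inter measurableSet_ball)
    ((measure_mono Set.inter_subset_right).trans_lt Metric.isBounded_ball.measure_lt_top)

theorem lintegral_poissonMeasure (r : ℝ≥0) (F : ℕ → ℝ≥0∞) :
    ∫⁻ n, F n ∂(poissonMeasure r) =
      ∑' n : ℕ, ENNReal.ofReal (Real.exp (-r) * r ^ n / n.factorial) * F n := by
  simp [poissonMeasure, lintegral_sum_measure, lintegral_smul_measure]

theorem poisson_mean (r : ℝ≥0) : ∫⁻ n, (n : ℝ≥0∞) ∂(poissonMeasure r) = r := by
  rw [lintegral_poissonMeasure, tsum_eq_zero_add' ENNReal.summable]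
  have h1 : ∀ n : ℕ, ENNReal.ofReal (Real.exp (-r) * r ^ (n + 1) / (n + 1).factorial) *
      ((n + 1 : ℕ) : ℝ≥0∞) = r * (ENNReal.ofReal (Real.exp (-r) * r ^ n / n.factorial) * 1) := by
    intro n
    rw [← ENNReal.ofReal_natCast, ← ENNReal.ofReal_mul (by positivity), mul_one,
      ← ENNReal.ofReal_coe_nnreal, ← ENNReal.ofReal_mul (by positivity)]
    congr 1
    rw [Nat.factorial_succ]
    push_cast
    field_simp
    ring
  simp_rw [h1]
  rw [ENNReal.tsum_mul_left, ← lintegral_poissonMeasure]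
  simp

theorem poisson_pgf (r : ℝ≥0) {a : ℝ} (ha : 0 ≤ a) :
    ∫⁻ n, ENNReal.ofReal (a ^ n) ∂(poissonMeasure r) =
      ENNReal.ofReal (Real.exp (-(r * (1 - a)))) := by
  rw [lintegral_poissonMeasure]
  have h1 : ∀ n : ℕ, ENNReal.ofReal (Real.exp (-r) * r ^ n / n.factorial) *
      ENNReal.ofReal (a ^ n) =
        ENNReal.ofReal (Real.exp (-r)) * ENNReal.ofReal ((r * a) ^ n / n.factorial) := by
    intro n
    rw [← ENNReal.ofReal_mul (by positivity), ← ENNReal.ofReal_mul (by positivity)]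
    congr 1
    rw [mul_pow]
    ring
  simp_rw [h1]
  have hs := NormedSpace.expSeries_div_hasSum_exp ((r : ℝ) * a)
  rw [ENNReal.tsum_mul_left, ← ENNReal.ofReal_tsum_of_nonneg (fun n => by positivity) hs.summable,
    hs.tsum_eq, ← Real.exp_eq_exp_ℝ, ← ENNReal.ofReal_mul (by positivity), ← Real.exp_add]
  congr 2
  ring

namespace IsHPPP

variable {Ω : Type*} [MeasurableSpace Ω] {P : Measure Ω} {lam : ℝ} {Φ : Ω → Set Plane}

theorem lintegral_count (h : IsHPPP P lam Φ) {B : Set Plane} (hB : MeasurableSet B)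
    (hfin : volume B < ⊤) (F : ℕ∞ → ℝ≥0∞) :
    ∫⁻ ω, F (Φ ω ∩ B).encard ∂P =
      ∫⁻ n, F (n : ℕ∞) ∂(poissonMeasure (lam * (volume B).toReal).toNNReal) := by
  rw [← lintegral_map (f := F) .of_discrete (h.measurable_count B hB), h.law_count B hB hfin,
    lintegral_map .of_discrete .of_discrete]

theorem measure_count (h : IsHPPP P lam Φ) {B : Set Plane} (hB : MeasurableSet B)
    (hfin : volume B < ⊤) (s : Set ℕ∞) :
    P {ω | (Φ ω ∩ B).encard ∈ s} =
      poissonMeasure (lam * (volume B).toReal).toNNReal {n : ℕ | (n : ℕ∞) ∈ s} := by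
  have := congrArg (fun μ => μ s) (h.law_count B hB hfin)
  rwa [Measure.map_apply (h.measurable_count B hB) .of_discrete,
    Measure.map_apply .of_discrete .of_discrete] at this

theorem measure_count_eq_zero (h : IsHPPP P lam Φ) (hlam : 0 ≤ lam) {B : Set Plane}
    (hB : MeasurableSet B) (hfin : volume B < ⊤) :
    P {ω | (Φ ω ∩ B).encard = 0} = ENNReal.ofReal (Real.exp (-lam * (volume B).toReal)) := by
  have h0 := h.measure_count hB hfin {0}
  have : {n : ℕ | (n : ℕ∞) ∈ ({0} : Set ℕ∞)} = {0} := by ext n; simp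
  rw [this, poissonMeasure_singleton] at h0
  have h1 : 0 ≤ lam * (volume B).toReal := by positivity
  simpa [Real.coe_toNNReal _ h1] using h0

theorem measure_count_eq_one (h : IsHPPP P lam Φ) (hlam : 0 ≤ lam) {B : Set Plane}
    (hB : MeasurableSet B) (hfin : volume B < ⊤) :
    P {ω | (Φ ω ∩ B).encard = 1} = ENNReal.ofReal
      (Real.exp (-lam * (volume B).toReal) * (lam * (volume B).toReal)) := by
  have h0 := h.measure_count hB hfin {1}
  have : {n : ℕ | (n : ℕ∞) ∈ ({1} : Set ℕ∞)} = {1} := by ext n; simp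
  rw [this, poissonMeasure_singleton] at h0
  have h1 : 0 ≤ lam * (volume B).toReal := by positivity
  simpa [Real.coe_toNNReal _ h1] using h0

theorem ae_finite (h : IsHPPP P lam Φ) {B : Set Plane}
    (hB : MeasurableSet B) (hfin : volume B < ⊤) : ∀ᵐ ω ∂P, (Φ ω ∩ B).Finite := by
  have h0 := h.measure_count hB hfin {⊤}
  have : {n : ℕ | (n : ℕ∞) ∈ ({⊤} : Set ℕ∞)} = ∅ := by ext n; simp
  rw [this, measure_empty] at h0
  rw [ae_iff]
  simpa [← Set.encard_lt_top_iff] using h0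

theorem ae_locallyFinite (h : IsHPPP P lam Φ) :
    ∀ᵐ ω ∂P, ∀ n : ℕ, (Φ ω ∩ Metric.ball 0 n).Finite :=
  ae_all_iff.2 fun _ => h.ae_finite measurableSet_ball Metric.isBounded_ball.measure_lt_top

theorem mean_count (h : IsHPPP P lam Φ) {B : Set Plane} (hB : MeasurableSet B)
    (hfin : volume B < ⊤) :
    ∫⁻ ω, ((Φ ω ∩ B).encard : ℝ≥0∞) ∂P = ENNReal.ofReal lam * volume B := by
  rw [h.lintegral_count hB hfin (fun n => (n : ℝ≥0∞))]
  simp only [ENat.toENNReal_coe]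
  rw [poisson_mean, ← ENNReal.ofReal, ENNReal.ofReal_mul' (by positivity),
    ENNReal.ofReal_toReal hfin.ne]

theorem lintegral_pow_count (h : IsHPPP P lam Φ) (hlam : 0 ≤ lam) {B : Set Plane}
    (hB : MeasurableSet B) (hfin : volume B < ⊤) {a : ℝ} (ha : 0 ≤ a) :
    ∫⁻ ω, ENNReal.ofReal (a ^ (Φ ω ∩ B).encard.toNat) ∂P =
      ENNReal.ofReal (Real.exp (-(lam * (volume B).toReal * (1 - a)))) := by
  rw [h.lintegral_count hB hfin (fun n => ENNReal.ofReal (a ^ n.toNat))]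
  simp only [ENat.toNat_natCast]
  rw [poisson_pgf _ ha, Real.coe_toNNReal _ (by positivity)]

end IsHPPP

/-! ### Grid approximation and Campbell's formula for isolated points. -/

/-- The index of the square of side length `1 / (k + 1)` that contains a point. -/
def gridIndex (k : ℕ) (c : Plane) : ℤ × ℤ := (⌊(k + 1 : ℝ) * c 0⌋, ⌊(k + 1 : ℝ) * c 1⌋)

/-- The lower left corner of a square of the grid of side length `1 / (k + 1)`. -/
def gridCorner (k : ℕ) (i : ℤ × ℤ) : Plane := !₂[(i.1 : ℝ) / (k + 1), (i.2 : ℝ) / (k + 1)]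

theorem measurable_gridIndex (k : ℕ) : Measurable (gridIndex k) := by
  unfold gridIndex
  refine Measurable.prodMk ?_ ?_ <;> exact Int.measurable_floor.comp (by fun_prop)

theorem tendsto_four_div : Tendsto (fun k : ℕ => 4 / (k + 1 : ℝ)) atTop (𝓝 0) := by
  have := (tendsto_one_div_add_atTop_nhds_zero_nat (𝕜 := ℝ)).const_mul 4
  simpa [div_eq_mul_inv] using this

/-- The diagonal of a square is √2 / (k + 1); the constant 2 is a convenient upper bound. -/
theorem norm_sub_gridCorner_le (k : ℕ) (c : Plane) :
    ‖c - gridCorner k (gridIndex k c)‖ ≤ 2 / (k + 1 : ℝ) := by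
  have hk : (0 : ℝ) < k + 1 := by positivity
  have key : ∀ t : ℝ, |t - (⌊(k + 1 : ℝ) * t⌋ : ℝ) / (k + 1)| ≤ 1 / (k + 1 : ℝ) := by
    intro t
    have h1 := Int.floor_le ((k + 1 : ℝ) * t)
    have h2 := Int.lt_floor_add_one ((k + 1 : ℝ) * t)
    have h3 : t - (⌊(k + 1 : ℝ) * t⌋ : ℝ) / (k + 1) =
        ((k + 1 : ℝ) * t - ⌊(k + 1 : ℝ) * t⌋) / (k + 1) := by
      field_simp
    rw [h3, abs_div, abs_of_pos hk, abs_of_nonneg (by linarith)]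
    gcongr
    linarith
  rw [EuclideanSpace.norm_eq, Fin.sum_univ_two, Real.sqrt_le_iff]
  refine ⟨by positivity, ?_⟩
  have h0 := key (c 0)
  have h1 := key (c 1)
  have e : (2 / (k + 1 : ℝ)) ^ 2 = 4 * (1 / (k + 1 : ℝ)) ^ 2 := by ring
  have h0' := pow_le_pow_left₀ (abs_nonneg _) h0 2
  have h1' := pow_le_pow_left₀ (abs_nonneg _) h1 2
  have h4 : 0 ≤ (1 / (k + 1 : ℝ)) ^ 2 := by positivity
  simp only [gridCorner, gridIndex, PiLp.sub_apply, Real.norm_eq_abs, Matrix.cons_val_zero,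
    Matrix.cons_val_one]
  linarith

/-- A point `c` of `S` is isolated with respect to `φ` if `φ c` is positive at all other points of
`S`. -/
def isolatedPoints (φ : Plane → Plane → ℝ) (S : Set Plane) : Set Plane :=
  {c | ∀ y ∈ S \ {c}, 0 < φ c y}

/-- The set `{φ c ≤ 0}` for `c` in a square of the grid, enlarged so as to depend only on the
square. -/
def gridVoid (φ : Plane → Plane → ℝ) (k : ℕ) (i : ℤ × ℤ) : Set Plane :=
  {y | φ (gridCorner k i) y ≤ 2 / (k + 1 : ℝ)}

/-- `S` has exactly one point in the part in `B` of a square, and no other point in the enlarged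
void. -/
def GridIsolated (φ : Plane → Plane → ℝ) (B : Set Plane) (k : ℕ) (i : ℤ × ℤ) (S : Set Plane) :
    Prop :=
  (S ∩ (gridIndex k ⁻¹' {i} ∩ B)).encard = 1 ∧
    (S ∩ (gridVoid φ k i \ (gridIndex k ⁻¹' {i} ∩ B))).encard = 0

section Deterministic

variable {φ : Plane → Plane → ℝ} (hLip : ∀ c c' y, φ c y ≤ φ c' y + ‖c - c'‖)
  (hdiag : ∀ c, φ c c ≤ 0)

-- The Lipschitz property in c lets the void move to the corner of the square at the cost of raising
-- the level by the distance to the corner.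
include hLip in
theorem subset_gridVoid (k : ℕ) (c : Plane) :
    {y | φ c y ≤ 0} ⊆ gridVoid φ k (gridIndex k c) := by
  intro y hy
  have h1 := hLip (gridCorner k (gridIndex k c)) c y
  have h2 := norm_sub_gridCorner_le k c
  rw [norm_sub_rev] at h2
  simp only [gridVoid, Set.mem_ofPred_eq] at hy ⊢
  linarith

-- The level 4 / (k + 1) is the enlargement 2 / (k + 1) plus the cost of moving back from the corner
-- to c.
include hLip in
theorem gridVoid_subset (k : ℕ) (c : Plane) :
    gridVoid φ k (gridIndex k c) ⊆ {y | φ c y ≤ 4 / (k + 1 : ℝ)} := by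
  intro y hy
  have h1 := hLip c (gridCorner k (gridIndex k c)) y
  have h2 := norm_sub_gridCorner_le k c
  have h3 : (4 : ℝ) / (k + 1) = 2 / (k + 1) + 2 / (k + 1) := by ring
  simp only [gridVoid, Set.mem_ofPred_eq] at hy ⊢
  linarith

include hLip hdiag in
theorem square_subset_gridVoid (k : ℕ) (i : ℤ × ℤ) :
    gridIndex k ⁻¹' {i} ⊆ gridVoid φ k i := by
  rintro c rfl
  exact subset_gridVoid hLip k c (hdiag c)

/-- A square that counts holds exactly one point of S ∩ B, and every point lies in exactly one
square; so squares may be counted through their points. -/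
theorem tsum_gridIsolated (B : Set Plane) (k : ℕ) (S : Set Plane) :
    ∑' i, {i | GridIsolated φ B k i S}.indicator (fun _ => (1 : ℝ≥0∞)) i =
      ∑' c : ↥(S ∩ B), {i | GridIsolated φ B k i S}.indicator (fun _ => (1 : ℝ≥0∞))
        (gridIndex k c) := by
  have h1 : ∀ i, {i | GridIsolated φ B k i S}.indicator (fun _ => (1 : ℝ≥0∞)) i =
      ∑' c : ↥(S ∩ B), if gridIndex k c = i then
        {i | GridIsolated φ B k i S}.indicator (fun _ => (1 : ℝ≥0∞)) i else 0 := by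
    intro i
    by_cases hi : GridIsolated φ B k i S
    · obtain ⟨p, hp⟩ := Set.encard_eq_one.1 hi.1
      have hpm : p ∈ S ∩ (gridIndex k ⁻¹' {i} ∩ B) := hp ▸ Set.mem_singleton p
      rw [tsum_eq_single (⟨p, hpm.1, hpm.2.2⟩ : ↥(S ∩ B))]
      · exact (if_pos (show gridIndex k p = i from hpm.2.1)).symm
      · rintro ⟨c, hcS, hcB⟩ hne
        rw [if_neg]
        intro hci
        have : c ∈ S ∩ (gridIndex k ⁻¹' {i} ∩ B) := ⟨hcS, hci, hcB⟩
        rw [hp] at this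
        exact hne (Subtype.ext this)
    · rw [Set.indicator_of_notMem (by exact hi)]
      simp
  rw [tsum_congr h1, ENNReal.tsum_comm]
  refine tsum_congr fun c => ?_
  rw [tsum_eq_single (gridIndex k c)]
  · rw [if_pos rfl]
  · intro i hi
    rw [if_neg hi.symm]

theorem tsum_gridIsolated_le (B : Set Plane) (k : ℕ) (S : Set Plane) :
    ∑' i, {i | GridIsolated φ B k i S}.indicator (fun _ => (1 : ℝ≥0∞)) i ≤
      ((S ∩ B).encard : ℝ≥0∞) := by
  rw [tsum_gridIsolated, ← ENNReal.tsum_set_one]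
  exact ENNReal.tsum_le_tsum fun c => Set.indicator_le_self' (by simp) _

-- If c is isolated, only finitely many points of S lie in {φ c ≤ 4}, so φ c has a positive minimum
-- over those other than c, and the enlarged void eventually excludes them. If c is not isolated,
-- the offending point lies in the enlarged void for every k, so the grid condition always fails.
include hLip hdiag in
theorem eventually_gridIsolated_iff (hbdd : ∀ c t, Bornology.IsBounded {y | φ c y ≤ t})
    {B S : Set Plane} (hS : ∀ n : ℕ, (S ∩ Metric.ball 0 n).Finite) {c : Plane} (hc : c ∈ S ∩ B) :
    ∀ᶠ k in atTop, GridIsolated φ B k (gridIndex k c) S ↔ c ∈ isolatedPoints φ S := by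
  by_cases hiso : c ∈ isolatedPoints φ S
  · have hfin : (S ∩ {y | φ c y ≤ 4}).Finite := by
      obtain ⟨r, hr⟩ := (hbdd c 4).subset_ball 0
      obtain ⟨n, hn⟩ := exists_nat_ge r
      exact (hS n).subset (Set.inter_subset_inter_right _
        (hr.trans (Metric.ball_subset_ball hn)))
    have hev : ∀ᶠ k : ℕ in atTop, ∀ y ∈ (S ∩ {y | φ c y ≤ 4}), y ≠ c → 4 / (k + 1 : ℝ) < φ c y := by
      rw [hfin.eventually_all]
      intro y hy
      by_cases hyc : y = c
      · simp [hyc]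
      · have h0 : 0 < φ c y := hiso y ⟨hy.1, hyc⟩
        filter_upwards [tendsto_four_div.eventually_lt_const h0] with k hk _ using hk
    filter_upwards [hev] with k hk
    refine iff_of_true ?_ hiso
    have hsub : S ∩ gridVoid φ k (gridIndex k c) ⊆ {c} := by
      rintro y ⟨hyS, hyV⟩
      by_contra hyc
      have h1 : φ c y ≤ 4 / (k + 1 : ℝ) := gridVoid_subset hLip k c hyV
      have h2 : (4 : ℝ) / (k + 1) ≤ 4 := div_le_self (by norm_num) (by simp)
      exact absurd (hk y ⟨hyS, h1.trans h2⟩ hyc) (not_lt.2 h1)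
    constructor
    · rw [Set.encard_eq_one]
      refine ⟨c, Set.Subset.antisymm ?_ (Set.singleton_subset_iff.2 ⟨hc.1, rfl, hc.2⟩)⟩
      rintro y ⟨hyS, hyQ, -⟩
      exact hsub ⟨hyS, square_subset_gridVoid hLip hdiag k _ hyQ⟩
    · rw [Set.encard_eq_zero, Set.eq_empty_iff_forall_notMem]
      rintro y ⟨hyS, hyV, hyQ⟩
      have hyc : y = c := hsub ⟨hyS, hyV⟩
      exact hyQ ⟨by rw [hyc]; rfl, hyc ▸ hc.2⟩
  · refine Eventually.of_forall fun k => iff_of_false ?_ hiso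
    rintro ⟨h1, h2⟩
    apply hiso
    intro y hy
    by_contra hneg
    have hyV : y ∈ gridVoid φ k (gridIndex k c) := subset_gridVoid hLip k c (not_lt.1 hneg)
    by_cases hyQ : y ∈ gridIndex k ⁻¹' {gridIndex k c} ∩ B
    · obtain ⟨p, hp⟩ := Set.encard_eq_one.1 h1
      have hcp : c ∈ ({p} : Set Plane) := hp ▸ ⟨hc.1, rfl, hc.2⟩
      have hyp : y ∈ ({p} : Set Plane) := hp ▸ ⟨hy.1, hyQ⟩
      exact hy.2 (hyp.trans hcp.symm)
    · rw [Set.encard_eq_zero] at h2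
      exact (Set.eq_empty_iff_forall_notMem.1 h2) y ⟨hy.1, hyV, hyQ⟩

include hLip hdiag in
theorem tendsto_tsum_gridIsolated (hbdd : ∀ c t, Bornology.IsBounded {y | φ c y ≤ t})
    {B S : Set Plane} (hS : ∀ n : ℕ, (S ∩ Metric.ball 0 n).Finite) (hSB : (S ∩ B).Finite) :
    Tendsto (fun k => ∑' i, {i | GridIsolated φ B k i S}.indicator (fun _ => (1 : ℝ≥0∞)) i) atTop
      (𝓝 (∑' c : ↥(S ∩ B), (isolatedPoints φ S).indicator (fun _ => (1 : ℝ≥0∞)) c)) := by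
  simp_rw [tsum_gridIsolated]
  have := hSB.fintype
  simp_rw [tsum_fintype]
  refine tendsto_finsetSum _ fun c _ => tendsto_nhds_of_eventually_eq ?_
  filter_upwards [eventually_gridIsolated_iff hLip hdiag hbdd hS c.2] with k hk
  by_cases hi : (c : Plane) ∈ isolatedPoints φ S
  · have hg : gridIndex k c ∈ {i | GridIsolated φ B k i S} := hk.2 hi
    rw [Set.indicator_of_mem hg, Set.indicator_of_mem hi]
  · have hg : gridIndex k c ∉ {i | GridIsolated φ B k i S} := fun hg => hi (hk.1 hg)
    rw [Set.indicator_of_notMem hg, Set.indicator_of_notMem hi]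

end Deterministic

section Limit

variable {φ : Plane → Plane → ℝ} (hLip : ∀ c c' y, φ c y ≤ φ c' y + ‖c - c'‖)
  (hmeas : ∀ c, Measurable (φ c)) (hbdd : ∀ c t, Bornology.IsBounded {y | φ c y ≤ t})

-- The enlarged voids are squeezed between {φ c ≤ 0} and the sets {φ c ≤ 4 / (k + 1)}, which
-- decrease to it and have finite area.
include hLip hmeas hbdd in
theorem tendsto_volume_gridVoid (c : Plane) :
    Tendsto (fun k => (volume (gridVoid φ k (gridIndex k c))).toReal) atTop
      (𝓝 (volume {y | φ c y ≤ 0}).toReal) := by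
  refine (ENNReal.tendsto_toReal (hbdd c 0).measure_lt_top.ne).comp ?_
  have hup : Tendsto (fun k : ℕ => volume {y | φ c y ≤ 4 / (k + 1 : ℝ)}) atTop
      (𝓝 (volume {y | φ c y ≤ 0})) := by
    have hI : {y | φ c y ≤ 0} = ⋂ k : ℕ, {y | φ c y ≤ 4 / (k + 1 : ℝ)} := by
      ext y
      simp only [Set.mem_ofPred_eq, Set.mem_iInter]
      exact ⟨fun h k => h.trans (by positivity), fun h => ge_of_tendsto' tendsto_four_div h⟩
    rw [hI]
    refine tendsto_measure_iInter_atTop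
      (fun k => (measurableSet_le (hmeas c) measurable_const).nullMeasurableSet) ?_
      ⟨0, (hbdd c _).measure_lt_top.ne⟩
    intro m n hmn y hy
    have : (m : ℝ) ≤ n := by exact_mod_cast hmn
    have hy' : φ c y ≤ 4 / (n + 1 : ℝ) := hy
    exact hy'.trans (div_le_div_of_nonneg_left (by norm_num) (by positivity) (by linarith))
  exact tendsto_of_tendsto_of_tendsto_of_le_of_le tendsto_const_nhds hup
    (fun k => measure_mono (subset_gridVoid hLip k c))
    (fun k => measure_mono (gridVoid_subset hLip k c))

end Limit

namespace IsHPPP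

variable {Ω : Type*} [MeasurableSpace Ω] {P : Measure Ω} {lam : ℝ} {Φ : Ω → Set Plane}

/-- Counts in A and D \ A are independent, and the two factors exp(-λ|A|) and exp(-λ|D \ A|) combine
into exp(-λ|D|). -/
theorem measure_single_and_void (h : IsHPPP P lam Φ) (hlam : 0 ≤ lam) {A D : Set Plane}
    (hA : MeasurableSet A) (hD : MeasurableSet D) (hAD : A ⊆ D) (hfin : volume D < ⊤) :
    P {ω | (Φ ω ∩ A).encard = 1 ∧ (Φ ω ∩ (D \ A)).encard = 0} =
      ENNReal.ofReal lam * volume A * ENNReal.ofReal (Real.exp (-lam * (volume D).toReal)) := by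
  have hAfin : volume A < ⊤ := (measure_mono hAD).trans_lt hfin
  have hDA : volume (D \ A) < ⊤ := (measure_mono Set.sdiff_subset).trans_lt hfin
  have hind := h.indep_count 2 ![A, D \ A] (by simp [Fin.forall_fin_two, hA, hD.diff hA])
    (by
      have hd : Disjoint A (D \ A) := Set.disjoint_sdiff_right
      intro i j hij
      fin_cases i <;> fin_cases j <;> first | exact absurd rfl hij | simpa using hd |
        simpa using hd.symm)
  have h2 := (hind.indepFun (i := 0) (j := 1) (by simp)).measure_inter_preimage_eq_mul {1} {0}
    .of_discrete .of_discrete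
  simp only [Matrix.cons_val_zero, Matrix.cons_val_one] at h2
  have e : {ω | (Φ ω ∩ A).encard = 1 ∧ (Φ ω ∩ (D \ A)).encard = 0} =
      (fun ω => (Φ ω ∩ A).encard) ⁻¹' {1} ∩ (fun ω => (Φ ω ∩ (D \ A)).encard) ⁻¹' {0} := rfl
  rw [e, h2]
  have e1 := h.measure_count_eq_one hlam hA hAfin
  have e0 := h.measure_count_eq_zero hlam (hD.diff hA) hDA
  change P {ω | (Φ ω ∩ A).encard = 1} * P {ω | (Φ ω ∩ (D \ A)).encard = 0} = _
  rw [e1, e0, ← ENNReal.ofReal_mul (by positivity)]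
  have hv : (volume D).toReal = (volume A).toReal + (volume (D \ A)).toReal := by
    rw [← ENNReal.toReal_add hAfin.ne hDA.ne, measure_sdiff hAD hA.nullMeasurableSet hAfin.ne,
      add_tsub_cancel_of_le (measure_mono hAD)]
  rw [← ENNReal.ofReal_toReal hAfin.ne, ← ENNReal.ofReal_mul hlam,
    ← ENNReal.ofReal_mul (by positivity), hv, ENNReal.toReal_ofReal (by positivity)]
  congr 1
  rw [mul_add, Real.exp_add]
  ring

variable {φ : Plane → Plane → ℝ}

/-- The integrand on the right is constant on each square, so its integral is the sum over squares
of the probabilities in `measure_single_and_void`. The condition `hdiag` puts each square inside its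
own void. -/
theorem lintegral_tsum_gridIsolated (h : IsHPPP P lam Φ) (hlam : 0 ≤ lam)
    (hLip : ∀ c c' y, φ c y ≤ φ c' y + ‖c - c'‖) (hdiag : ∀ c, φ c c ≤ 0)
    (hmeas : ∀ c, Measurable (φ c)) (hbdd : ∀ c t, Bornology.IsBounded {y | φ c y ≤ t})
    {B : Set Plane} (hB : MeasurableSet B) (k : ℕ) :
    (Measurable fun ω => ∑' i, {i | GridIsolated φ B k i (Φ ω)}.indicator
      (fun _ => (1 : ℝ≥0∞)) i) ∧
    ∫⁻ ω, ∑' i, {i | GridIsolated φ B k i (Φ ω)}.indicator (fun _ => (1 : ℝ≥0∞)) i ∂P =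
      ∫⁻ c in B, ENNReal.ofReal lam * ENNReal.ofReal
        (Real.exp (-lam * (volume (gridVoid φ k (gridIndex k c))).toReal)) := by
  have hQ : ∀ i, MeasurableSet (gridIndex k ⁻¹' {i} ∩ B) := fun i =>
    (measurable_gridIndex k (measurableSet_singleton i)).inter hB
  have hV : ∀ i, MeasurableSet (gridVoid φ k i) := fun i =>
    measurableSet_le (hmeas _) measurable_const
  have hE : ∀ i, MeasurableSet {ω | GridIsolated φ B k i (Φ ω)} := fun i =>
    (h.measurable_count _ (hQ i) (measurableSet_singleton 1)).inter
      (h.measurable_count _ ((hV i).diff (hQ i)) (measurableSet_singleton 0))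
  have hswap : ∀ i ω, {i | GridIsolated φ B k i (Φ ω)}.indicator (fun _ => (1 : ℝ≥0∞)) i =
      {ω | GridIsolated φ B k i (Φ ω)}.indicator (fun _ => (1 : ℝ≥0∞)) ω := fun i ω => rfl
  simp_rw [hswap]
  have hm : ∀ i, Measurable fun ω =>
      {ω | GridIsolated φ B k i (Φ ω)}.indicator (fun _ => (1 : ℝ≥0∞)) ω := fun i =>
    measurable_const.indicator (hE i)
  refine ⟨Measurable.tsum hm, ?_⟩
  rw [lintegral_tsum fun i => (hm i).aemeasurable]
  have hU : B = ⋃ i, gridIndex k ⁻¹' {i} ∩ B := by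
    ext c
    simp
  conv_rhs => rw [hU]
  rw [lintegral_iUnion hQ]
  · refine tsum_congr fun i => ?_
    rw [lintegral_indicator_const (hE i), one_mul]
    have h1 := h.measure_single_and_void hlam (hQ i) (hV i)
      (Set.inter_subset_left.trans (square_subset_gridVoid hLip hdiag k i))
      (hbdd _ _).measure_lt_top
    refine h1.trans ?_
    rw [setLIntegral_congr_fun (g := fun _ => ENNReal.ofReal lam * ENNReal.ofReal
        (Real.exp (-lam * (volume (gridVoid φ k i)).toReal))) (hQ i)]
    · rw [setLIntegral_const]
      ring
    · rintro c ⟨hc, -⟩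
      have hc' : gridIndex k c = i := hc
      simp only [hc']
  · intro i j hij
    refine Set.disjoint_left.2 fun c hci hcj => hij ?_
    exact hci.1.symm.trans hcj.1

/-- Campbell's formula for the points of a Poisson process that are isolated with respect to `φ`. -/
theorem lintegral_tsum_isolatedPoints (h : IsHPPP P lam Φ) (hlam : 0 ≤ lam)
    (hLip : ∀ c c' y, φ c y ≤ φ c' y + ‖c - c'‖) (hdiag : ∀ c, φ c c ≤ 0)
    (hmeas : ∀ c, Measurable (φ c)) (hbdd : ∀ c t, Bornology.IsBounded {y | φ c y ≤ t})
    {B : Set Plane} (hB : MeasurableSet B) (hfin : volume B < ⊤) :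
    (AEMeasurable (fun ω => ∑' c : ↥(Φ ω ∩ B),
      (isolatedPoints φ (Φ ω)).indicator (fun _ => (1 : ℝ≥0∞)) (c : Plane)) P) ∧
    ∫⁻ ω, ∑' c : ↥(Φ ω ∩ B), (isolatedPoints φ (Φ ω)).indicator (fun _ => (1 : ℝ≥0∞)) (c : Plane) ∂P
      = ∫⁻ c in B, ENNReal.ofReal lam * ENNReal.ofReal
        (Real.exp (-lam * (volume {y | φ c y ≤ 0}).toReal)) := by
  have hk := fun k => h.lintegral_tsum_gridIsolated hlam hLip hdiag hmeas hbdd hB k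
  have hlim : ∀ᵐ ω ∂P, Tendsto
      (fun k => ∑' i, {i | GridIsolated φ B k i (Φ ω)}.indicator (fun _ => (1 : ℝ≥0∞)) i) atTop
      (𝓝 (∑' c : ↥(Φ ω ∩ B), (isolatedPoints φ (Φ ω)).indicator (fun _ => (1 : ℝ≥0∞)) c)) := by
    filter_upwards [h.ae_locallyFinite, h.ae_finite hB hfin] with ω h1 h2
    exact tendsto_tsum_gridIsolated hLip hdiag hbdd h1 h2
  refine ⟨aemeasurable_of_tendsto_metrizable_ae _ (fun k => (hk k).1.aemeasurable) hlim, ?_⟩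
  have hL := tendsto_lintegral_of_dominated_convergence
    (bound := fun ω => ((Φ ω ∩ B).encard : ℝ≥0∞)) (fun k => (hk k).1)
    (fun k => ae_of_all _ fun ω => tsum_gridIsolated_le B k (Φ ω))
    (by rw [h.mean_count hB hfin]; exact ENNReal.mul_ne_top ENNReal.ofReal_ne_top hfin.ne) hlim
  simp_rw [fun k => (hk k).2] at hL
  -- The expected grid counts converge to the expected number of isolated points; the right sides of
  -- the grid formula converge as well, dominated by the constant λ on a set of finite area.
  refine tendsto_nhds_unique hL ?_
  refine tendsto_lintegral_of_dominated_convergence (bound := fun _ => ENNReal.ofReal lam)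
    (fun k => ?_) (fun k => ae_of_all _ fun c => ?_) ?_ (ae_of_all _ fun c => ?_)
  · have : Measurable fun i : ℤ × ℤ => ENNReal.ofReal lam * ENNReal.ofReal
        (Real.exp (-lam * (volume (gridVoid φ k i)).toReal)) := .of_discrete
    exact this.comp (measurable_gridIndex k)
  · refine mul_le_of_le_one_right' ?_
    rw [ENNReal.ofReal_le_one, Real.exp_le_one_iff]
    have : 0 ≤ lam * (volume (gridVoid φ k (gridIndex k c))).toReal := by positivity
    linarith
  · rw [setLIntegral_const]
    exact ENNReal.mul_ne_top ENNReal.ofReal_ne_top hfin.ne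
  · refine ENNReal.Tendsto.const_mul ?_ (Or.inr ENNReal.ofReal_ne_top)
    refine (ENNReal.continuous_ofReal.tendsto _).comp ?_
    refine (Real.continuous_exp.tendsto _).comp ?_
    exact (tendsto_volume_gridVoid hLip hmeas hbdd c).const_mul _

end IsHPPP

/-! ### Locally finite configurations and measurable choice of the nearest point. -/

/-- A set of points that has finitely many points in each bounded set. -/
def LocallyFinite (S : Set Plane) : Prop := ∀ n : ℕ, (S ∩ Metric.ball 0 n).Finite

/-- Points of norm at least ‖x‖ + r + 1 are at distance at least r + 1 from x; only finitely many
others remain, and each leaves a positive margin. -/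
theorem LocallyFinite.exists_gap {S : Set Plane} (hS : LocallyFinite S) {x : Plane} {r : ℝ}
    {F : Set Plane} (h : ∀ y ∈ S \ F, r < ‖x - y‖) :
    ∃ ε > 0, ∀ y ∈ S \ F, r + ε < ‖x - y‖ := by
  obtain ⟨n, hn⟩ := exists_nat_ge (‖x‖ + r + 1)
  have h1 : ∀ᶠ ε : ℝ in 𝓝[>] 0, ∀ y ∈ S ∩ Metric.ball 0 n, y ∉ F → r + ε < ‖x - y‖ := by
    rw [(hS n).eventually_all]
    intro y hy
    by_cases hyF : y ∈ F
    · simp [hyF]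
    · have hlt := h y ⟨hy.1, hyF⟩
      have : ∀ᶠ ε : ℝ in 𝓝[>] 0, ε < ‖x - y‖ - r :=
        nhdsWithin_le_nhds (eventually_lt_nhds (by linarith))
      filter_upwards [this] with ε hε _
      linarith
  have h2 : ∀ᶠ ε : ℝ in 𝓝[>] 0, ε < 1 := nhdsWithin_le_nhds (eventually_lt_nhds (by norm_num))
  obtain ⟨ε, ⟨h3, h4⟩, h5⟩ := ((h1.and h2).and self_mem_nhdsWithin).exists
  refine ⟨ε, h5, fun y hy => ?_⟩
  by_cases hyn : y ∈ Metric.ball (0 : Plane) n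
  · exact h3 y ⟨hy.1, hyn⟩ hy.2
  · rw [mem_ball_zero_iff, not_lt] at hyn
    have := norm_sub_norm_le y x
    rw [norm_sub_rev] at this
    linarith

section NearestPoint

/-- The point of a configuration that is closest to the origin, if this point is unique. -/
def nearestPoint (S : Set Plane) : Plane :=
  open Classical in
  if h : ∃ p : Plane, ∃ q : ℚ, S ∩ Metric.ball 0 (q : ℝ) = {p} then h.choose else 0

theorem nearestPoint_eq {S : Set Plane} {p : Plane} {q : ℚ} (h : S ∩ Metric.ball 0 (q : ℝ) = {p}) :
    nearestPoint S = p := by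
  have hex : ∃ p : Plane, ∃ q : ℚ, S ∩ Metric.ball 0 (q : ℝ) = {p} := ⟨p, q, h⟩
  have key : ∀ (p p' : Plane) (q q' : ℚ), q ≤ q' → S ∩ Metric.ball 0 (q : ℝ) = {p} →
      S ∩ Metric.ball 0 (q' : ℝ) = {p'} → p = p' := by
    intro p p' q q' hqq h h'
    have : p ∈ S ∩ Metric.ball 0 (q : ℝ) := h ▸ rfl
    have h2 : p ∈ S ∩ Metric.ball 0 (q' : ℝ) :=
      ⟨this.1, Metric.ball_subset_ball (by exact_mod_cast hqq) this.2⟩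
    rw [h'] at h2
    exact h2
  have h1 : nearestPoint S = hex.choose := dif_pos hex
  rw [h1]
  obtain ⟨q', hq'⟩ := hex.choose_spec
  rcases le_total q q' with hqq | hqq
  · exact (key _ _ _ _ hqq h hq').symm
  · exact key _ _ _ _ hqq hq' h

/-- Because the radii in `nearestPoint` are rational, countably many counts decide whether a ball
isolates a single point and whether this point is in A. The remaining configurations have the
default value 0, whence the second part of the decomposition `e`. -/
theorem measurable_nearestPoint : Measurable (α := Config) nearestPoint := by
  intro A hA
  have hball : ∀ q : ℚ, MeasurableSet[configSigma] {S : Set Plane | Set.encard (S ∩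
      Metric.ball 0 (q : ℝ)) = 1} := fun q =>
    measurable_encard_inter measurableSet_ball (measurableSet_singleton 1)
  have hballA : ∀ q : ℚ, MeasurableSet[configSigma] {S : Set Plane | Set.encard (S ∩
      (Metric.ball 0 (q : ℝ) ∩ A)) = 1} := fun q =>
    measurable_encard_inter (measurableSet_ball.inter hA) (measurableSet_singleton 1)
  have e : nearestPoint ⁻¹' A =
      (⋃ q : ℚ, {S : Set Plane | Set.encard (S ∩ Metric.ball 0 (q : ℝ)) = 1} ∩
        {S : Set Plane | Set.encard (S ∩ (Metric.ball 0 (q : ℝ) ∩ A)) = 1}) ∪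
      ((⋃ q : ℚ, {S : Set Plane | Set.encard (S ∩ Metric.ball 0 (q : ℝ)) = 1})ᶜ ∩
        {_S : Set Plane | (0 : Plane) ∈ A}) := by
    ext S
    by_cases hS : ∃ q : ℚ, Set.encard (S ∩ Metric.ball 0 (q : ℝ)) = 1
    · have hmem : S ∈ ⋃ q : ℚ, {S : Set Plane | Set.encard (S ∩
          Metric.ball 0 (q : ℝ)) = 1} := Set.mem_iUnion.2 hS
      constructor
      · intro hSA
        left
        obtain ⟨q, hq⟩ := hS
        refine Set.mem_iUnion.2 ⟨q, hq, ?_⟩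
        obtain ⟨p, hp⟩ := Set.encard_eq_one.1 hq
        have hpA : p ∈ A := by
          have : nearestPoint S ∈ A := hSA
          rwa [nearestPoint_eq hp] at this
        refine Set.encard_eq_one.2 ⟨p, ?_⟩
        rw [← Set.inter_assoc, hp]
        exact Set.inter_eq_left.2 (Set.singleton_subset_iff.2 hpA)
      · rintro (h | h)
        · obtain ⟨q, hq, hqA⟩ := Set.mem_iUnion.1 h
          obtain ⟨p, hp⟩ := Set.encard_eq_one.1 hq
          obtain ⟨p', hp'⟩ := Set.encard_eq_one.1 hqA
          rw [← Set.inter_assoc, hp] at hp'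
          have h2 : p' ∈ ({p} : Set Plane) ∩ A := hp' ▸ rfl
          have h3 : p' = p := h2.1
          change nearestPoint S ∈ A
          rw [nearestPoint_eq hp, ← h3]
          exact h2.2
        · exact absurd hmem h.1
    · have hnm : S ∉ ⋃ q : ℚ, {S : Set Plane | Set.encard (S ∩
          Metric.ball 0 (q : ℝ)) = 1} := fun h => by
        obtain ⟨q, hq⟩ := Set.mem_iUnion.1 h
        exact hS ⟨q, hq⟩
      have h0 : nearestPoint S = 0 := by
        refine dif_neg ?_
        rintro ⟨p, q, hpq⟩
        exact hS ⟨q, Set.encard_eq_one.2 ⟨p, hpq⟩⟩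
      constructor
      · intro hSA
        have h1 : nearestPoint S ∈ A := hSA
        rw [h0] at h1
        exact Or.inr ⟨hnm, h1⟩
      · rintro (h | h)
        · obtain ⟨q, hq⟩ := Set.mem_iUnion.1 h
          exact absurd ⟨q, hq.1⟩ hS
        · change nearestPoint S ∈ A
          rw [h0]
          exact h.2
  change MeasurableSet[configSigma] (nearestPoint ⁻¹' A)
  rw [e]
  exact (MeasurableSet.iUnion fun q => (hball q).inter (hballA q)).union
    ((MeasurableSet.iUnion hball).compl.inter (MeasurableSet.const _))

theorem LocallyFinite.exists_ball_eq_singleton {S : Set Plane} (hS : LocallyFinite S) {c : Plane}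
    (hc : c ∈ S) (h : ∀ y ∈ S \ {c}, ‖c‖ < ‖y‖) : ∃ q : ℚ, S ∩ Metric.ball 0 (q : ℝ) = {c} := by
  obtain ⟨ε, hε, hgap⟩ := hS.exists_gap (x := 0) (r := ‖c‖) (F := {c}) (by simpa using h)
  obtain ⟨q, hq1, hq2⟩ := exists_rat_btwn (show ‖c‖ < ‖c‖ + ε by linarith)
  refine ⟨q, Set.Subset.antisymm ?_ ?_⟩
  · rintro y ⟨hyS, hyq⟩
    by_contra hyc
    have := hgap y ⟨hyS, hyc⟩
    rw [zero_sub, norm_neg] at this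
    rw [mem_ball_zero_iff] at hyq
    linarith
  · rintro y rfl
    exact ⟨hc, by rwa [mem_ball_zero_iff]⟩

theorem IsNearest.eq_of_ball {S : Set Plane} {c p : Plane} {q : ℚ} (hc : IsNearest S c)
    (hp : S ∩ Metric.ball 0 (q : ℝ) = {p}) : c = p ∧ ∀ y ∈ S \ {c}, ‖c‖ < ‖y‖ := by
  have hpm : p ∈ S ∩ Metric.ball 0 (q : ℝ) := hp ▸ rfl
  have hpq := hpm.2
  rw [mem_ball_zero_iff] at hpq
  have hcp : c = p := by
    have : c ∈ S ∩ Metric.ball 0 (q : ℝ) :=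
      ⟨hc.1, by rw [mem_ball_zero_iff]; exact (hc.2 p hpm.1).trans_lt hpq⟩
    rw [hp] at this
    exact this
  refine ⟨hcp, fun y hy => ?_⟩
  by_contra hneg
  have hyb : y ∈ S ∩ Metric.ball 0 (q : ℝ) :=
    ⟨hy.1, by rw [mem_ball_zero_iff, ]; rw [hcp] at hneg; exact (not_lt.1 hneg).trans_lt hpq⟩
  rw [hp] at hyb
  exact hy.2 (hyb.trans hcp.symm)

end NearestPoint

/-! ### Law of the nearest point and of its cell. -/

section Union

/-- Positive at `y` if and only if `c` is closer than `y` both to the origin and to `x`. -/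
def nearestVoid (x c y : Plane) : ℝ := min (‖y‖ - ‖c‖) (‖x - y‖ - ‖x - c‖)

theorem nearestVoid_le (x c c' y : Plane) :
    nearestVoid x c y ≤ nearestVoid x c' y + ‖c - c'‖ := by
  unfold nearestVoid
  rw [← min_add_add_right]
  refine min_le_min ?_ ?_
  · have := norm_sub_norm_le c' c
    rw [norm_sub_rev] at this
    linarith
  · have := norm_sub_norm_le (x - c') (x - c)
    rw [sub_sub_sub_cancel_left] at this
    linarith

theorem nearestVoid_self (x c : Plane) : nearestVoid x c c ≤ 0 := by simp [nearestVoid]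

theorem measurable_nearestVoid (x c : Plane) : Measurable (nearestVoid x c) := by
  unfold nearestVoid
  fun_prop

theorem nearestVoid_sublevel (x c : Plane) (t : ℝ) : {y | nearestVoid x c y ≤ t} =
    Metric.closedBall 0 (‖c‖ + t) ∪ Metric.closedBall x (‖x - c‖ + t) := by
  ext y
  simp only [nearestVoid, min_le_iff, Set.mem_ofPred_eq, Set.mem_union, Metric.mem_closedBall,
    dist_eq_norm, sub_zero, norm_sub_rev y x, sub_le_iff_le_add']

theorem isBounded_nearestVoid (x c : Plane) (t : ℝ) :
    Bornology.IsBounded {y | nearestVoid x c y ≤ t} := by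
  rw [nearestVoid_sublevel]
  exact Metric.isBounded_closedBall.union Metric.isBounded_closedBall

/-- Circles are null sets. The void consists of closed discs, whereas `pca` is written with open
ones. -/
theorem volume_closedBall_diff (x c : Plane) :
    volume (Metric.closedBall x ‖x - c‖ \ Metric.closedBall 0 ‖c‖) =
      volume (Metric.ball x ‖x - c‖ \ Metric.ball 0 ‖c‖) := by
  have h1 : Metric.closedBall x ‖x - c‖ =ᵐ[volume] Metric.ball x ‖x - c‖ := by
    refine (ae_eq_of_subset_of_measure_ge Metric.ball_subset_closedBall ?_
      measurableSet_ball.nullMeasurableSet Metric.isBounded_closedBall.measure_lt_top.ne).symm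
    rw [Measure.addHaar_closedBall_eq_addHaar_ball]
  have h0 : Metric.closedBall 0 ‖c‖ =ᵐ[volume] Metric.ball (0 : Plane) ‖c‖ := by
    refine (ae_eq_of_subset_of_measure_ge Metric.ball_subset_closedBall ?_
      measurableSet_ball.nullMeasurableSet Metric.isBounded_closedBall.measure_lt_top.ne).symm
    rw [Measure.addHaar_closedBall_eq_addHaar_ball]
  exact measure_congr (h1.diff h0)

/-- This additive splitting is what factors the void probability into the density of the nearest
point and `pca`. -/
theorem volume_nearestVoid (x c : Plane) : (volume {y | nearestVoid x c y ≤ 0}).toReal =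
    (volume (Metric.closedBall (0 : Plane) ‖c‖)).toReal +
      (volume (Metric.ball x ‖x - c‖ \ Metric.ball 0 ‖c‖)).toReal := by
  rw [nearestVoid_sublevel, add_zero, add_zero, ← volume_closedBall_diff, ← ENNReal.toReal_add
    Metric.isBounded_closedBall.measure_lt_top.ne
    (Metric.isBounded_closedBall.subset Set.sdiff_subset).measure_lt_top.ne,
    ← measure_union Set.disjoint_sdiff_right
      (measurableSet_closedBall.diff measurableSet_closedBall), Set.union_sdiff_self]

theorem measurable_pca (lamA : ℝ) : Measurable fun p : Plane × Plane => pca lamA p.1 p.2 := by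
  have hs : MeasurableSet {q : (Plane × Plane) × Plane |
      dist q.2 q.1.1 < ‖q.1.1 - q.1.2‖ ∧ ¬ dist q.2 0 < ‖q.1.2‖} :=
    MeasurableSet.inter (measurableSet_lt (f := fun q : (Plane × Plane) × Plane => dist q.2 q.1.1)
      (g := fun q => ‖q.1.1 - q.1.2‖) (by fun_prop) (by fun_prop))
      (measurableSet_lt (f := fun q : (Plane × Plane) × Plane => dist q.2 0)
        (g := fun q => ‖q.1.2‖) (by fun_prop) (by fun_prop)).compl
  have h := measurable_measure_prodMk_left (ν := (volume : Measure Plane)) hs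
  exact Real.measurable_exp.comp ((h.ennreal_toReal).const_mul (-lamA))

theorem measurable_pca_comp (lamA : ℝ) {β : Type*} [MeasurableSpace β] {f g : β → Plane}
    (hf : Measurable f) (hg : Measurable g) : Measurable fun b => pca lamA (f b) (g b) :=
  Measurable.comp (f := fun b => (f b, g b)) (measurable_pca lamA) (hf.prodMk hg)

theorem pca_pos (lamA : ℝ) (x c : Plane) : 0 < pca lamA x c := Real.exp_pos _

theorem pca_le_one {lamA : ℝ} (h : 0 ≤ lamA) (x c : Plane) : pca lamA x c ≤ 1 := by
  rw [pca, Real.exp_le_one_iff]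
  have : 0 ≤ lamA * (volume (Metric.ball x ‖x - c‖ \ Metric.ball 0 ‖c‖)).toReal := by positivity
  linarith

/-- The density of the distribution of the point of a Poisson process closest to the origin. -/
def nearestDensity (lam : ℝ) (c : Plane) : ℝ≥0∞ :=
  ENNReal.ofReal lam * ENNReal.ofReal
    (Real.exp (-lam * (volume (Metric.closedBall (0 : Plane) ‖c‖)).toReal))

theorem nearestDensity_eq (lam : ℝ) (c : Plane) : nearestDensity lam c =
    ENNReal.ofReal lam * ENNReal.ofReal (Real.exp (-(lam * Real.pi) * ‖c‖ ^ 2)) := by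
  rw [nearestDensity, Measure.addHaar_closedBall_eq_addHaar_ball,
    EuclideanSpace.volume_ball_fin_two]
  congr 3
  simp [ENNReal.toReal_ofReal Real.pi_pos.le]
  ring

theorem measurable_nearestDensity (lam : ℝ) : Measurable (nearestDensity lam) := by
  have : nearestDensity lam = fun c => ENNReal.ofReal lam *
      ENNReal.ofReal (Real.exp (-(lam * Real.pi) * ‖c‖ ^ 2)) := funext (nearestDensity_eq lam)
  rw [this]
  fun_prop

/-- The density is λ exp(-λπ‖c‖²), a Gaussian in the plane. -/
theorem lintegral_nearestDensity {lam : ℝ} (hlam : 0 < lam) :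
    ∫⁻ c, nearestDensity lam c = 1 := by
  simp_rw [nearestDensity_eq]
  have hb : 0 < lam * Real.pi := by positivity
  have hI := GaussianFourier.integral_rexp_neg_mul_sq_norm (V := Plane) hb
  have hpos : 0 < (Real.pi / (lam * Real.pi)) ^ ((Module.finrank ℝ Plane : ℝ) / 2) := by
    positivity
  rw [lintegral_const_mul _ (by fun_prop), ← ofReal_integral_eq_lintegral_ofReal
    (Integrable.of_integral_ne_zero (by rw [hI]; exact hpos.ne'))
    (ae_of_all _ fun _ => (Real.exp_pos _).le), hI, ← ENNReal.ofReal_mul hlam.le,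
    ENNReal.ofReal_eq_one]
  have : ((Module.finrank ℝ Plane : ℝ) / 2) = 1 := by simp
  rw [this, Real.rpow_one]
  field_simp

theorem nearestVoid_density (lam : ℝ) (x c : Plane) :
    ENNReal.ofReal lam * ENNReal.ofReal
        (Real.exp (-lam * (volume {y | nearestVoid x c y ≤ 0}).toReal)) =
      nearestDensity lam c * ENNReal.ofReal (pca lam x c) := by
  rw [nearestDensity, mul_assoc, ← ENNReal.ofReal_mul (Real.exp_pos _).le, volume_nearestVoid, mul_add,
    Real.exp_add, pca]

end Union

namespace IsHPPP

variable {Ω : Type*} [MeasurableSpace Ω] {P : Measure Ω} {lam : ℝ} {Φ : Ω → Set Plane}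

/-- For x = 0 the isolated points are the strict minimisers of the norm, so there is at most one,
and its expected number in a disc is at most the probability of `G`. As the disc grows, Campbell's
formula makes this expectation tend to the total mass 1 of `nearestDensity`. -/
theorem ae_exists_ball_eq_singleton [IsProbabilityMeasure P] (h : IsHPPP P lam Φ) (hlam : 0 < lam) :
    ∀ᵐ ω ∂P, ∃ p : Plane, ∃ q : ℚ, Φ ω ∩ Metric.ball 0 (q : ℝ) = {p} := by
  set G : Set Ω := ⋃ q : ℚ, {ω | (Φ ω ∩ Metric.ball 0 (q : ℝ)).encard = 1} with hG
  have hGm : MeasurableSet G := MeasurableSet.iUnion fun q =>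
    h.measurable_count _ measurableSet_ball (measurableSet_singleton 1)
  have hn : ∀ n : ℕ, ∫⁻ c in Metric.ball (0 : Plane) n, nearestDensity lam c ≤ P G := by
    intro n
    have h1 := (h.lintegral_tsum_isolatedPoints hlam.le (nearestVoid_le 0) (nearestVoid_self 0)
      (measurable_nearestVoid 0) (isBounded_nearestVoid 0) (measurableSet_ball (x := 0) (ε := n))
      Metric.isBounded_ball.measure_lt_top).2
    have h2 : ∀ c : Plane, nearestDensity lam c = nearestDensity lam c *
        ENNReal.ofReal (pca lam 0 c) := by
      intro c
      simp [pca]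
    rw [lintegral_congr h2]
    simp_rw [nearestVoid_density] at h1
    rw [← h1, ← lintegral_indicator_one hGm]
    refine lintegral_mono_ae ?_
    filter_upwards [h.ae_locallyFinite] with ω hω
    have hiso : ∀ c : Plane, c ∈ isolatedPoints (nearestVoid 0) (Φ ω) →
        ∀ y ∈ Φ ω \ {c}, ‖c‖ < ‖y‖ := by
      intro c hc y hy
      have := hc y hy
      simpa [nearestVoid] using this
    by_cases hex : ∃ c ∈ Φ ω ∩ Metric.ball 0 n, c ∈ isolatedPoints (nearestVoid 0) (Φ ω)
    · obtain ⟨c, hc, hci⟩ := hex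
      obtain ⟨q, hq⟩ := LocallyFinite.exists_ball_eq_singleton hω hc.1 (hiso c hci)
      have hωG : ω ∈ G := Set.mem_iUnion.2 ⟨q, Set.encard_eq_one.2 ⟨c, hq⟩⟩
      rw [Set.indicator_of_mem hωG, tsum_eq_single ⟨c, hc⟩]
      · exact Set.indicator_le_self' (by simp) _
      · rintro ⟨d, hd⟩ hne
        have hdc : d ≠ c := fun h => hne (Subtype.ext h)
        refine Set.indicator_of_notMem (fun hdi => ?_) _
        exact lt_asymm (hiso c hci d ⟨hd.1, hdc⟩) (hiso d hdi c ⟨hc.1, hdc.symm⟩)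
    · have : ∀ c : ↥(Φ ω ∩ Metric.ball 0 n), (isolatedPoints (nearestVoid 0) (Φ ω)).indicator
          (fun _ => (1 : ℝ≥0∞)) (c : Plane) = 0 := fun c =>
        Set.indicator_of_notMem (fun hci => hex ⟨c, c.2, hci⟩) _
      rw [tsum_congr this]
      simp
  have h1 : 1 ≤ P G := by
    rw [← lintegral_nearestDensity hlam, ← setLIntegral_univ, ← Metric.iUnion_ball_nat (0 : Plane),
      setLIntegral_iUnion_of_directed]
    · exact iSup_le hn
    · exact Monotone.directed_le fun m n hmn => Metric.ball_subset_ball (by exact_mod_cast hmn)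
  have h2 : ∀ᵐ ω ∂P, ω ∈ G := (prob_compl_eq_zero_iff hGm).2 (le_antisymm prob_le_one h1)
  filter_upwards [h2] with ω hω
  obtain ⟨q, hq⟩ := Set.mem_iUnion.1 hω
  obtain ⟨p, hp⟩ := Set.encard_eq_one.1 hq
  exact ⟨p, q, hp⟩

/-- The joint law of the nearest point and of the event that `x` belongs to its Voronoi cell. -/
theorem measure_nearest_inter [IsProbabilityMeasure P] (h : IsHPPP P lam Φ) (hlam : 0 < lam)
    {c : Ω → Plane} (hcN : ∀ᵐ ω ∂P, IsNearest (Φ ω) (c ω)) (x : Plane) {B : Set Plane}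
    (hB : MeasurableSet B) (hfin : volume B < ⊤) :
    NullMeasurableSet (c ⁻¹' B ∩ {ω | x ∈ voronoiCell (Φ ω) (c ω)}) P ∧
    P (c ⁻¹' B ∩ {ω | x ∈ voronoiCell (Φ ω) (c ω)}) =
      ∫⁻ y in B, nearestDensity lam y * ENNReal.ofReal (pca lam x y) := by
  obtain ⟨h0, h1⟩ := h.lintegral_tsum_isolatedPoints hlam.le (nearestVoid_le x) (nearestVoid_self x)
      (measurable_nearestVoid x) (isBounded_nearestVoid x) hB hfin
  simp_rw [nearestVoid_density] at h1
  -- Almost surely the nearest point is unique, so it alone can be isolated for `nearestVoid x`, and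
  -- it is so exactly when x lies in its cell: the Campbell sum is an indicator.
  have hae : (fun ω => ∑' p : ↥(Φ ω ∩ B), (isolatedPoints (nearestVoid x) (Φ ω)).indicator
      (fun _ => (1 : ℝ≥0∞)) (p : Plane)) =ᵐ[P]
      (c ⁻¹' B ∩ {ω | x ∈ voronoiCell (Φ ω) (c ω)}).indicator 1 := by
    filter_upwards [hcN, h.ae_exists_ball_eq_singleton hlam] with ω hN hex
    obtain ⟨p, q, hpq⟩ := hex
    obtain ⟨-, hlt⟩ := hN.eq_of_ball hpq
    have hiso : ∀ d ∈ Φ ω, d ∈ isolatedPoints (nearestVoid x) (Φ ω) → d = c ω := by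
      intro d hd hdi
      by_contra hne
      have h1 := hdi (c ω) ⟨hN.1, fun h => hne h.symm⟩
      have h2 := hlt d ⟨hd, hne⟩
      rw [nearestVoid, lt_min_iff] at h1
      linarith [h1.1]
    by_cases hmem : ω ∈ c ⁻¹' B ∩ {ω | x ∈ voronoiCell (Φ ω) (c ω)}
    · rw [Set.indicator_of_mem hmem, tsum_eq_single ⟨c ω, hN.1, hmem.1⟩]
      · refine Set.indicator_of_mem (fun y hy => ?_) _
        have h1 := hmem.2 y hy
        have h2 := hlt y hy
        rw [nearestVoid, lt_min_iff]
        constructor <;> linarith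
      · rintro ⟨d, hd⟩ hne
        exact Set.indicator_of_notMem (fun hdi => hne (Subtype.ext (hiso d hd.1 hdi))) _
    · rw [Set.indicator_of_notMem hmem]
      have : ∀ d : ↥(Φ ω ∩ B), (isolatedPoints (nearestVoid x) (Φ ω)).indicator
          (fun _ => (1 : ℝ≥0∞)) (d : Plane) = 0 := by
        rintro ⟨d, hd⟩
        refine Set.indicator_of_notMem (fun hdi => hmem ?_) _
        have hdc := hiso d hd.1 hdi
        refine ⟨by rw [Set.mem_preimage, ← hdc]; exact hd.2, fun y hy => ?_⟩
        rw [← hdc] at hy ⊢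
        have h1 := hdi y hy
        rw [nearestVoid, lt_min_iff] at h1
        linarith [h1.2]
      rw [tsum_congr this]
      simp
  -- Here c is an arbitrary function; null measurability is inherited from the Campbell sum.
  have hnull : NullMeasurableSet (c ⁻¹' B ∩ {ω | x ∈ voronoiCell (Φ ω) (c ω)}) P := by
    have h2 : AEMeasurable ((c ⁻¹' B ∩ {ω | x ∈ voronoiCell (Φ ω) (c ω)}).indicator
      (1 : Ω → ℝ≥0∞)) P := h0.congr hae
    exact (aemeasurable_indicator_const_iff (1 : ℝ≥0∞)).1 h2
  refine ⟨hnull, ?_⟩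
  rw [← h1, lintegral_congr_ae hae, lintegral_indicator_one₀ hnull]

theorem nullMeasurableSet_voronoi [IsProbabilityMeasure P] (h : IsHPPP P lam Φ) (hlam : 0 < lam)
    {c : Ω → Plane} (hcN : ∀ᵐ ω ∂P, IsNearest (Φ ω) (c ω)) (x : Plane) :
    NullMeasurableSet {ω | x ∈ voronoiCell (Φ ω) (c ω)} P := by
  have : {ω | x ∈ voronoiCell (Φ ω) (c ω)} =
      ⋃ n : ℕ, (c ⁻¹' Metric.ball 0 n ∩ {ω | x ∈ voronoiCell (Φ ω) (c ω)}) := by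
    rw [← Set.iUnion_inter, ← Set.preimage_iUnion, Metric.iUnion_ball_nat, Set.preimage_univ,
      Set.univ_inter]
  rw [this]
  exact NullMeasurableSet.iUnion fun n => (h.measure_nearest_inter hlam hcN x measurableSet_ball
    Metric.isBounded_ball.measure_lt_top).1

/-- Given that the nearest point is at `c`, the point `x` belongs to its Voronoi cell with
probability `pca lam x c`. -/
theorem measure_voronoi [IsProbabilityMeasure P] (h : IsHPPP P lam Φ) (hlam : 0 < lam)
    {c : Ω → Plane} (hc : Measurable c) (hcN : ∀ᵐ ω ∂P, IsNearest (Φ ω) (c ω)) (x : Plane)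
    {A : Set Plane} (hA : MeasurableSet A) :
    P (c ⁻¹' A ∩ {ω | x ∈ voronoiCell (Φ ω) (c ω)}) =
      ∫⁻ y in A, ENNReal.ofReal (pca lam x y) ∂(P.map c) := by
  have hp : ∀ x : Plane, Measurable fun y => ENNReal.ofReal (pca lam x y) := fun x =>
    (measurable_pca_comp lam measurable_const measurable_id).ennreal_ofReal
  have hjoint : ∀ x : Plane, (P.restrict {ω | x ∈ voronoiCell (Φ ω) (c ω)}).map c =
      (volume.withDensity (nearestDensity lam)).withDensity
        (fun y => ENNReal.ofReal (pca lam x y)) := by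
    intro x
    refine measure_ext_of_volume_lt_top fun B hB hfin => ?_
    rw [Measure.map_apply hc hB, Measure.restrict_apply (hc hB),
      (h.measure_nearest_inter hlam hcN x hB hfin).2,
      ← withDensity_mul _ (measurable_nearestDensity lam) (hp x), withDensity_apply _ hB]
    rfl
  -- At x = 0 the cell event is almost sure and `pca` is 1, so the joint law reduces to the law of
  -- c.
  have hlaw : P.map c = volume.withDensity (nearestDensity lam) := by
    have h0 := hjoint 0
    have e : P.restrict {ω | (0 : Plane) ∈ voronoiCell (Φ ω) (c ω)} = P := by
      refine Measure.restrict_eq_self_of_ae_mem ?_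
      filter_upwards [hcN, h.ae_exists_ball_eq_singleton hlam] with ω hN hex
      obtain ⟨p, q, hpq⟩ := hex
      intro y hy
      simpa using (hN.eq_of_ball hpq).2 y hy
    have e' : (fun y : Plane => ENNReal.ofReal (pca lam 0 y)) = 1 := by
      ext y
      simp [pca]
    rwa [e, e', withDensity_one] at h0
  rw [← withDensity_apply _ hA, hlaw, ← hjoint x, Measure.map_apply hc hA,
    Measure.restrict_apply (hc hA)]

end IsHPPP

/-! ### The Palm distribution of the APs. -/

namespace HasPalmLaw

variable {Ω Ω₀ : Type*} [MeasurableSpace Ω] [MeasurableSpace Ω₀] {P : Measure Ω} {lam : ℝ}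
  {Φ : Ω → Set Plane} {P₀ : Measure Ω₀} {Φ₀ : Ω₀ → Set Plane}

/-- Testing the Palm formula on the unit disc suffices, since λ times its area is neither zero nor
infinite and can be cancelled. -/
theorem measure_eq_of_lintegral (h : HasPalmLaw P lam Φ P₀ Φ₀) (hlam : 0 < lam)
    {Γ : Set (Set Plane)} (hΓ : MeasurableSet[configSigma] Γ) {a : ℝ≥0∞}
    (ha : ∫⁻ ω, ∑' x : ↥(Φ ω ∩ Metric.ball 0 1), Γ.indicator (fun _ => (1 : ENNReal))
          ((fun y => y - (x : Plane)) '' Φ ω) ∂P =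
      ENNReal.ofReal lam * volume (Metric.ball (0 : Plane) 1) * a) : P₀ (Φ₀ ⁻¹' Γ) = a := by
  have hv : volume (Metric.ball (0 : Plane) 1) < ⊤ := Metric.isBounded_ball.measure_lt_top
  have h1 := h.palm Γ hΓ _ measurableSet_ball hv
  rw [ha] at h1
  refine (ENNReal.mul_right_inj ?_ ?_).1 h1.symm
  · refine mul_ne_zero (by simpa using hlam) (Metric.measure_ball_pos _ _ (by norm_num)).ne'
  · exact ENNReal.mul_ne_top ENNReal.ofReal_ne_top hv.ne

/-- When every translate is in Γ, the Palm sum is the number of points in the disc, whose mean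
forces the Palm probability of Γ to be 1. -/
theorem ae_of_forall_translate [IsProbabilityMeasure P₀] (h : HasPalmLaw P lam Φ P₀ Φ₀)
    (hΦ : IsHPPP P lam Φ) (hlam : 0 < lam)
    {Γ : Set (Set Plane)} (hΓ : MeasurableSet[configSigma] Γ)
    (hall : ∀ᵐ ω ∂P, ∀ x ∈ Φ ω, (fun y => y - x) '' Φ ω ∈ Γ) : ∀ᵐ ω ∂P₀, Φ₀ ω ∈ Γ := by
  have h1 : P₀ (Φ₀ ⁻¹' Γ) = 1 := by
    refine h.measure_eq_of_lintegral hlam hΓ ?_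
    rw [mul_one, ← hΦ.mean_count measurableSet_ball Metric.isBounded_ball.measure_lt_top]
    refine lintegral_congr_ae ?_
    filter_upwards [hall] with ω hω
    rw [← ENNReal.tsum_set_one]
    exact tsum_congr fun x => Set.indicator_of_mem (hω x x.2.1) _
  have hm : MeasurableSet (Φ₀ ⁻¹' Γ) := h.measurable hΓ
  exact (prob_compl_eq_zero_iff hm).2 h1

theorem ae_zero_mem [IsProbabilityMeasure P₀] (h : HasPalmLaw P lam Φ P₀ Φ₀)
    (hΦ : IsHPPP P lam Φ) (hlam : 0 < lam) : ∀ᵐ ω ∂P₀, (0 : Plane) ∈ Φ₀ ω := by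
  have hΓ : MeasurableSet[configSigma] {S : Set Plane | (S ∩ {0}).encard = 1} :=
    measurable_encard_inter (measurableSet_singleton (0 : Plane)) (measurableSet_singleton 1)
  have := h.ae_of_forall_translate hΦ hlam hΓ (ae_of_all _ fun ω x hx =>
    Set.encard_eq_one.2 ⟨0, Set.inter_eq_right.2 (Set.singleton_subset_iff.2 ⟨x, hx, sub_self x⟩)⟩)
  filter_upwards [this] with ω hω
  obtain ⟨p, hp⟩ := Set.encard_eq_one.1 hω
  have h2 : p ∈ Φ₀ ω ∩ {0} := hp ▸ rfl
  have h3 : p = 0 := h2.2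
  exact h3 ▸ h2.1

theorem ae_locallyFinite [IsProbabilityMeasure P₀] (h : HasPalmLaw P lam Φ P₀ Φ₀)
    (hΦ : IsHPPP P lam Φ) (hlam : 0 < lam) : ∀ᵐ ω ∂P₀, LocallyFinite (Φ₀ ω) := by
  refine ae_all_iff.2 fun n => ?_
  have hΓ : MeasurableSet[configSigma] {S : Set Plane | (S ∩ Metric.ball 0 n).encard ∈ Set.Iio ⊤} :=
    measurable_encard_inter (measurableSet_ball (x := (0 : Plane)) (ε := n)) .of_discrete
  have := h.ae_of_forall_translate hΦ hlam hΓ (by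
    filter_upwards [hΦ.ae_locallyFinite] with ω hω x _
    refine Set.encard_lt_top_iff.2 ?_
    obtain ⟨m, hm⟩ := exists_nat_ge (n + ‖x‖)
    refine ((hω m).image fun y => y - x).subset ?_
    rintro _ ⟨⟨y, hy, rfl⟩, hyn⟩
    refine ⟨y, ⟨hy, ?_⟩, rfl⟩
    rw [mem_ball_zero_iff] at hyn ⊢
    have := norm_le_norm_sub_add y x
    change ‖y - x‖ < n at hyn
    linarith)
  filter_upwards [this] with ω hω
  exact Set.encard_lt_top_iff.1 hω

/-- Seen from c, the point x is in the cell of the origin if and only if no other point lies in the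
closed disc of centre c + x and radius ‖x‖. This is isolation with a void whose area does not depend
on c, so the Campbell integrand is constant. -/
theorem measure_voronoi (h : HasPalmLaw P lam Φ P₀ Φ₀)
    (hΦ : IsHPPP P lam Φ) (hlam : 0 < lam) (x : Plane) :
    P₀ {ω | x ∈ voronoiCell (Φ₀ ω) 0} = ENNReal.ofReal (pca lam x 0) := by
  have e : {S : Set Plane | x ∈ voronoiCell S 0} =
      {S : Set Plane | (S ∩ (Metric.closedBall x ‖x‖ \ {0})).encard = 0} := by
    ext S
    simp only [voronoiCell, Set.mem_ofPred_eq, Set.encard_eq_zero,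
      Set.eq_empty_iff_forall_notMem, Set.mem_inter_iff, Set.mem_sdiff, Metric.mem_closedBall,
      Set.mem_singleton_iff, dist_eq_norm, sub_zero, norm_sub_rev x]
    refine forall_congr' fun y => ?_
    rw [← not_le]
    tauto
  have hΓ : MeasurableSet[configSigma] {S : Set Plane | x ∈ voronoiCell S 0} := by
    rw [e]
    exact measurable_encard_inter (measurableSet_closedBall.diff (measurableSet_singleton 0))
      (measurableSet_singleton 0)
  refine h.measure_eq_of_lintegral hlam hΓ ?_
  have hsub : ∀ c t, {y : Plane | ‖y - c - x‖ - ‖x‖ ≤ t} = Metric.closedBall (c + x) (‖x‖ + t) := by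
    intro c t
    ext y
    simp only [Set.mem_ofPred_eq, Metric.mem_closedBall, dist_eq_norm, sub_le_iff_le_add',
      sub_add_eq_sub_sub]
  have h1 := (hΦ.lintegral_tsum_isolatedPoints (φ := fun c y => ‖y - c - x‖ - ‖x‖) hlam.le
    (fun c c' y => by
      have := norm_sub_norm_le (y - c - x) (y - c' - x)
      rw [sub_sub_sub_cancel_right, sub_sub_sub_cancel_left, norm_sub_rev c'] at this
      linarith)
    (fun c => by simp) (fun c => by fun_prop)
    (fun c t => by rw [hsub]; exact Metric.isBounded_closedBall)
    (measurableSet_ball (x := (0 : Plane)) (ε := 1)) Metric.isBounded_ball.measure_lt_top).2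
  have hpca : ∀ c : Plane, ENNReal.ofReal (Real.exp (-lam * (volume {y : Plane |
      ‖y - c - x‖ - ‖x‖ ≤ 0}).toReal)) = ENNReal.ofReal (pca lam x 0) := by
    intro c
    rw [hsub, pca, add_zero, Measure.addHaar_closedBall_eq_addHaar_ball,
      Measure.addHaar_ball_center, ← Measure.addHaar_ball_center volume x]
    simp
  simp_rw [hpca] at h1
  rw [setLIntegral_const] at h1
  rw [mul_assoc, mul_comm (volume _), ← mul_assoc, ← h1]
  refine lintegral_congr fun ω => tsum_congr fun c => ?_
  have hiff : (fun y => y - (c : Plane)) '' Φ ω ∈ {S : Set Plane | x ∈ voronoiCell S 0} ↔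
      (c : Plane) ∈ isolatedPoints (fun c y => ‖y - c - x‖ - ‖x‖) (Φ ω) := by
    constructor
    · intro hv y hy
      have := hv (y - c) ⟨⟨y, hy.1, rfl⟩, fun h0 => hy.2 (sub_eq_zero.1 h0)⟩
      rw [sub_zero, norm_sub_rev] at this
      exact sub_pos.2 this
    · rintro hi _ ⟨⟨y, hy, rfl⟩, hne⟩
      have := hi y ⟨hy, fun h0 => hne (sub_eq_zero.2 h0)⟩
      rw [sub_zero, norm_sub_rev x]
      exact sub_pos.1 this
  by_cases hi : (c : Plane) ∈ isolatedPoints (fun c y => ‖y - c - x‖ - ‖x‖) (Φ ω)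
  · rw [Set.indicator_of_mem hi, Set.indicator_of_mem (hiff.2 hi)]
  · rw [Set.indicator_of_notMem hi, Set.indicator_of_notMem (fun hg => hi (hiff.1 hg))]

end HasPalmLaw

/-! ### Exponential gains and integrability of the path loss. -/

section Exponential

theorem lintegral_expMeasure {r : ℝ} {f : ℝ → ℝ≥0∞} (hf : Measurable f) :
    ∫⁻ x, f x ∂(expMeasure r) = ∫⁻ x, exponentialPDF r x * f x := by
  have hm : Measurable (exponentialPDF r) := (measurable_exponentialPDFReal r).ennreal_ofReal
  exact lintegral_withDensity_eq_lintegral_mul _ hm hf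

theorem ae_expMeasure_nonneg : ∀ᵐ x ∂(expMeasure 1), (0 : ℝ) ≤ x := by
  have hm : MeasurableSet {x : ℝ | 0 ≤ x}ᶜ := (measurableSet_le measurable_const measurable_id).compl
  rw [ae_iff]
  change expMeasure 1 {x : ℝ | 0 ≤ x}ᶜ = 0
  rw [← lintegral_indicator_one hm, lintegral_expMeasure (measurable_one.indicator hm)]
  refine (lintegral_congr fun x => ?_).trans lintegral_zero
  by_cases hx : 0 ≤ x
  · rw [Set.indicator_of_notMem (by simpa using hx), mul_zero]
  · rw [exponentialPDF_of_neg (not_le.1 hx), zero_mul]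

/-- Tilting the rate-1 density by exp(-tx) gives 1 / (1 + t) times the density of rate 1 + t. -/
theorem expMeasure_laplace {t : ℝ} (ht : 0 ≤ t) :
    ∫⁻ x, ENNReal.ofReal (Real.exp (-(t * x))) ∂(expMeasure 1) = ENNReal.ofReal (1 / (1 + t)) := by
  rw [lintegral_expMeasure (by fun_prop)]
  have h1 : ∀ x, exponentialPDF 1 x * ENNReal.ofReal (Real.exp (-(t * x))) =
      ENNReal.ofReal (1 / (1 + t)) * exponentialPDF (1 + t) x := by
    intro x
    rcases lt_or_ge x 0 with hx | hx
    · rw [exponentialPDF_of_neg hx, exponentialPDF_of_neg hx, zero_mul, mul_zero]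
    · rw [exponentialPDF_of_nonneg hx, exponentialPDF_of_nonneg hx,
        ← ENNReal.ofReal_mul (by positivity), ← ENNReal.ofReal_mul (by positivity)]
      congr 1
      have : Real.exp (-((1 + t) * x)) = Real.exp (-(1 * x)) * Real.exp (-(t * x)) := by
        rw [← Real.exp_add]
        ring_nf
      rw [this]
      field_simp
  have hm : Measurable (exponentialPDF (1 + t)) :=
    (measurable_exponentialPDFReal _).ennreal_ofReal
  rw [lintegral_congr h1, lintegral_const_mul _ hm, lintegral_exponentialPDF_eq_one (by positivity),
    mul_one]

theorem expMeasure_mean_lt_top : ∫⁻ x, ENNReal.ofReal x ∂(expMeasure 1) < ⊤ := by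
  rw [lintegral_expMeasure (by fun_prop)]
  -- From x ≤ 2 exp(x/2) follows x exp(-x) ≤ 2 exp(-x/2), which is four times the density of rate
  -- 1/2.
  have h1 : ∀ x, exponentialPDF 1 x * ENNReal.ofReal x ≤
      ENNReal.ofReal 4 * exponentialPDF (1 / 2) x := by
    intro x
    rcases lt_or_ge x 0 with hx | hx
    · rw [exponentialPDF_of_neg hx, zero_mul]
      exact zero_le
    · rw [exponentialPDF_of_nonneg hx, exponentialPDF_of_nonneg hx,
        ← ENNReal.ofReal_mul (by positivity), ← ENNReal.ofReal_mul (by positivity)]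
      refine ENNReal.ofReal_le_ofReal ?_
      have h2 : Real.exp (-(1 * x)) = Real.exp (-(1 / 2 * x)) * Real.exp (-(1 / 2 * x)) := by
        rw [← Real.exp_add]
        ring_nf
      have h3 : Real.exp (-(1 / 2 * x)) * Real.exp (1 / 2 * x) = 1 := by
        rw [← Real.exp_add]
        simp
      have h4 := Real.add_one_le_exp (1 / 2 * x)
      have h5 := Real.exp_pos (-(1 / 2 * x))
      rw [h2]
      nlinarith [mul_le_mul_of_nonneg_left h4 (mul_pos h5 h5).le]
  refine (lintegral_mono h1).trans_lt ?_
  have hm : Measurable (exponentialPDF (1 / 2)) :=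
    (measurable_exponentialPDFReal _).ennreal_ofReal
  rw [lintegral_const_mul _ hm, lintegral_exponentialPDF_eq_one (by positivity), mul_one]
  exact ENNReal.ofReal_lt_top

end Exponential

section PathLoss

/-- A function integrable over the plane that dominates the path loss away from the receiver. -/
def tailBound (α : ℝ) (y : Plane) : ℝ := ((1 + ‖y‖) / 2) ^ (-α)

theorem tailBound_nonneg (α : ℝ) (y : Plane) : 0 ≤ tailBound α y := by
  unfold tailBound
  positivity

theorem lintegral_tailBound_lt_top {α : ℝ} (hα : 2 < α) :
    ∫⁻ y : Plane, ENNReal.ofReal (tailBound α y) < ⊤ := by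
  have hI : Integrable (fun y : Plane => (1 + ‖y‖) ^ (-α)) :=
    integrable_one_add_norm (by simpa using hα)
  have h2 : Integrable (tailBound α) := by
    have : tailBound α = fun y => (1 + ‖y‖) ^ (-α) / 2 ^ (-α) := by
      ext y
      rw [tailBound, Real.div_rpow (by positivity) (by norm_num)]
    rw [this]
    exact hI.div_const _
  exact h2.lintegral_lt_top

/-- The base of `tailBound` is the mean of 1 and ‖y‖: at most ‖y‖ outside the unit disc, at most 1
inside. -/
theorem norm_rpow_le_tailBound {α : ℝ} (hα : 0 < α) {y : Plane} (hy : 1 ≤ ‖y‖) :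
    ‖y‖ ^ (-α) ≤ tailBound α y :=
  Real.rpow_le_rpow_of_nonpos (by positivity) (by linarith) (by linarith)

theorem one_le_tailBound {α : ℝ} (hα : 0 < α) {y : Plane} (hy : ‖y‖ ≤ 1) :
    1 ≤ tailBound α y :=
  Real.one_le_rpow_of_pos_of_le_one_of_nonpos (by positivity) (by linarith) (by linarith)

theorem gammaFun_nonneg {t : ℝ} (ht : 0 ≤ t) : 0 ≤ gammaFun t := by
  rw [gammaFun, sub_nonneg, div_le_one (by positivity)]
  linarith

theorem gammaFun_le_one {t : ℝ} (ht : 0 ≤ t) : gammaFun t ≤ 1 := by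
  rw [gammaFun]
  have : 0 ≤ 1 / (1 + t) := by positivity
  linarith

theorem gammaFun_le {t : ℝ} (ht : 0 ≤ t) : gammaFun t ≤ t := by
  rw [gammaFun, sub_le_comm, le_div_iff₀ (by positivity)]
  nlinarith

theorem measurable_gammaFun : Measurable gammaFun := by
  unfold gammaFun
  fun_prop

/-- The bound γ ≤ 1 handles the singularity of the path loss and γ(t) ≤ t handles its tail. -/
theorem gammaFun_pathLoss_le {α τ : ℝ} (hα : 0 < α) (hτ : 0 ≤ τ) (y : Plane) :
    gammaFun (τ * ‖y‖ ^ (-α)) ≤ max 1 τ * tailBound α y := by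
  have h0 : 0 ≤ τ * ‖y‖ ^ (-α) := by positivity
  have hb := tailBound_nonneg α y
  rcases le_total ‖y‖ 1 with hy | hy
  · calc _ ≤ 1 := gammaFun_le_one h0
      _ ≤ 1 * tailBound α y := by rw [one_mul]; exact one_le_tailBound hα hy
      _ ≤ _ := mul_le_mul_of_nonneg_right (le_max_left _ _) hb
  · calc _ ≤ τ * ‖y‖ ^ (-α) := gammaFun_le h0
      _ ≤ τ * tailBound α y := mul_le_mul_of_nonneg_left (norm_rpow_le_tailBound hα hy) hτ
      _ ≤ _ := mul_le_mul_of_nonneg_right (le_max_right _ _) hb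

theorem lintegral_gammaFun_lt_top {α τ : ℝ} (hα : 2 < α) (hτ : 0 ≤ τ) (z : Plane) :
    ∫⁻ y : Plane, ENNReal.ofReal (gammaFun (τ * ‖y - z‖ ^ (-α))) < ⊤ := by
  rw [lintegral_sub_right_eq_self (fun y => ENNReal.ofReal (gammaFun (τ * ‖y‖ ^ (-α)))) z]
  refine (lintegral_mono fun y =>
    ENNReal.ofReal_le_ofReal (gammaFun_pathLoss_le (by linarith) hτ y)).trans_lt ?_
  have hm : Measurable (tailBound α) := by
    unfold tailBound
    fun_prop
  simp_rw [ENNReal.ofReal_mul (le_max_of_le_left zero_le_one : (0 : ℝ) ≤ max 1 τ)]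
  rw [lintegral_const_mul _ hm.ennreal_ofReal]
  exact ENNReal.mul_lt_top ENNReal.ofReal_lt_top (lintegral_tailBound_lt_top hα)

end PathLoss

/-! ### First moments of the UEs and convergence of the interference. -/

theorem encard_range_inter {U : ℕ → Plane} (hU : Function.Injective U) (B : Set Plane) :
    (((Set.range U ∩ B).encard : ℕ∞) : ℝ≥0∞) = ∑' n, B.indicator (fun _ => (1 : ℝ≥0∞)) (U n) := by
  have h1 : Set.range U ∩ B = U '' (U ⁻¹' B) := by rw [Set.image_preimage_eq_range_inter]
  rw [h1, hU.encard_image, ← ENNReal.tsum_set_one, tsum_subtype (U ⁻¹' B) fun _ => (1 : ℝ≥0∞)]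
  rfl

namespace IsUELayer

variable {Ω : Type*} [MeasurableSpace Ω] {P : Measure Ω} {Φa : Ω → Set Plane} {lamU : ℝ}
  {U : ℕ → Ω → Plane} {g : ℕ → Ω → ℝ}

theorem sum_map_position (h : IsUELayer P Φa lamU U g) :
    Measure.sum (fun n => P.map (U n)) = ENNReal.ofReal lamU • (volume : Measure Plane) := by
  refine measure_ext_of_volume_lt_top fun B hB hfin => ?_
  rw [Measure.sum_apply _ hB, Measure.smul_apply, smul_eq_mul, ← h.poisson.mean_count hB hfin]
  have h1 : ∀ᵐ ω ∂P, (((Set.range (fun n => U n ω) ∩ B).encard : ℕ∞) : ℝ≥0∞) =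
      ∑' n, (U n ⁻¹' B).indicator 1 ω := by
    filter_upwards [h.distinct] with ω hω
    exact encard_range_inter hω B
  rw [lintegral_congr_ae h1, lintegral_tsum fun n =>
    (measurable_one.indicator (h.measurable_position n hB)).aemeasurable]
  refine tsum_congr fun n => ?_
  rw [lintegral_indicator_one (h.measurable_position n hB),
    Measure.map_apply (h.measurable_position n) hB]

theorem tsum_lintegral_position (h : IsUELayer P Φa lamU U g) {f : Plane → ℝ≥0∞}
    (hf : Measurable f) :
    ∑' n, ∫⁻ ω, f (U n ω) ∂P = ENNReal.ofReal lamU * ∫⁻ y, f y := by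
  rw [← smul_eq_mul, ← lintegral_smul_measure, ← h.sum_map_position, lintegral_sum_measure]
  exact tsum_congr fun n => (lintegral_map hf (h.measurable_position n)).symm

theorem lintegral_gain (h : IsUELayer P Φa lamU U g) (n : ℕ) {f : ℝ → ℝ≥0∞} (hf : Measurable f) :
    ∫⁻ ω, f (g n ω) ∂P = ∫⁻ x, f x ∂(expMeasure 1) := by
  rw [← h.law_gain n, lintegral_map hf (h.measurable_gain n)]

theorem ae_gain_nonneg (h : IsUELayer P Φa lamU U g) : ∀ᵐ ω ∂P, ∀ n, 0 ≤ g n ω := by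
  refine ae_all_iff.2 fun n => ?_
  have := ae_expMeasure_nonneg
  rw [← h.law_gain n] at this
  exact ae_of_ae_map (h.measurable_gain n).aemeasurable this

theorem indepFun_gain_position (h : IsUELayer P Φa lamU U g) (n m : ℕ) :
    IndepFun (g n) (U m) P := by
  rw [IndepFun_iff_Indep]
  exact indep_of_indep_of_le h.indep_gain_position
    (le_iSup (fun n => MeasurableSpace.comap (g n) inferInstance) n)
    (le_sup_of_le_right (le_iSup (fun n => MeasurableSpace.comap (U n) inferInstance) m))

/-- The path loss is not integrable near z, so a first-moment argument works only outside the unit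
disc around z. Inside the disc there are almost surely finitely many UEs, each with a finite term.
-/
theorem ae_tsum_ne_top (h : IsUELayer P Φa lamU U g) {α : ℝ} (hα : 2 < α)
    (z : Plane) : ∀ᵐ ω ∂P, ∑' n, ENNReal.ofReal (g n ω) *
      ENNReal.ofReal (‖U n ω - z‖ ^ (-α)) ≠ ⊤ := by
  set w : Plane → ℝ≥0∞ := fun y => ENNReal.ofReal (‖y - z‖ ^ (-α)) with hw
  have hwm : Measurable w := by fun_prop
  have hbm : MeasurableSet (Metric.ball z 1) := measurableSet_ball
  have hfar : ∀ᵐ ω ∂P, ∑' n, ENNReal.ofReal (g n ω) * (Metric.ball z 1)ᶜ.indicator w (U n ω) < ⊤ := by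
    have hm : ∀ n, Measurable fun ω =>
        ENNReal.ofReal (g n ω) * (Metric.ball z 1)ᶜ.indicator w (U n ω) := fun n =>
      (h.measurable_gain n).ennreal_ofReal.mul
        ((hwm.indicator hbm.compl).comp (h.measurable_position n))
    refine ae_lt_top (Measurable.tsum hm) ?_
    rw [lintegral_tsum fun n => (hm n).aemeasurable]
    have h1 : ∀ n, ∫⁻ ω, ENNReal.ofReal (g n ω) * (Metric.ball z 1)ᶜ.indicator w (U n ω) ∂P =
        (∫⁻ x, ENNReal.ofReal x ∂(expMeasure 1)) *
          ∫⁻ ω, (Metric.ball z 1)ᶜ.indicator w (U n ω) ∂P := by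
      intro n
      rw [← h.lintegral_gain n ENNReal.measurable_ofReal]
      exact lintegral_mul_eq_lintegral_mul_lintegral_of_indepFun''
        (h.measurable_gain n).ennreal_ofReal.aemeasurable
        ((hwm.indicator hbm.compl).comp (h.measurable_position n)).aemeasurable
        ((h.indepFun_gain_position n n).comp ENNReal.measurable_ofReal (hwm.indicator hbm.compl))
    simp_rw [h1]
    rw [ENNReal.tsum_mul_left, h.tsum_lintegral_position (hwm.indicator hbm.compl)]
    refine ENNReal.mul_ne_top expMeasure_mean_lt_top.ne
      (ENNReal.mul_ne_top ENNReal.ofReal_ne_top ?_)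
    have h2 : ∀ y, (Metric.ball z 1)ᶜ.indicator w y ≤ ENNReal.ofReal (tailBound α (y - z)) := by
      intro y
      refine Set.indicator_apply_le' (fun hy => ?_) (fun _ => zero_le)
      refine ENNReal.ofReal_le_ofReal (norm_rpow_le_tailBound (by linarith) ?_)
      rw [← dist_eq_norm]
      exact not_lt.1 hy
    refine ((lintegral_mono h2).trans_lt ?_).ne
    rw [lintegral_sub_right_eq_self (fun y => ENNReal.ofReal (tailBound α y)) z]
    exact lintegral_tailBound_lt_top hα
  filter_upwards [hfar, h.distinct, h.poisson.ae_finite hbm Metric.isBounded_ball.measure_lt_top]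
    with ω h1 h2 h3
  have hfin : ((fun n => U n ω) ⁻¹' Metric.ball z 1).Finite := by
    refine Set.Finite.of_finite_image (f := fun n => U n ω) ?_ h2.injOn
    rwa [Set.image_preimage_eq_range_inter]
  have hsplit : ∀ n, ENNReal.ofReal (g n ω) * w (U n ω) =
      ENNReal.ofReal (g n ω) * (Metric.ball z 1)ᶜ.indicator w (U n ω) +
      ENNReal.ofReal (g n ω) * (Metric.ball z 1).indicator w (U n ω) := by
    intro n
    rw [← mul_add]
    congr 1
    exact (congrFun (Set.indicator_compl_add_self (Metric.ball z 1) w) (U n ω)).symm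
  rw [tsum_congr hsplit, ENNReal.tsum_add]
  refine ENNReal.add_ne_top.2 ⟨h1.ne, ?_⟩
  rw [tsum_eq_sum (s := hfin.toFinset)]
  · refine ENNReal.sum_ne_top.2 fun n _ => ENNReal.mul_ne_top ENNReal.ofReal_ne_top ?_
    exact ((Set.indicator_le_self _ w _).trans_lt ENNReal.ofReal_lt_top).ne
  · intro n hn
    rw [Set.indicator_of_notMem, mul_zero]
    simpa using hn

theorem interferenceTerm_nonneg {Pu α : ℝ} (hPu : 0 ≤ Pu) {V : Set Plane} {u : ℕ → Plane}
    {γ : ℕ → ℝ} (hγ : ∀ n, 0 ≤ γ n) (z : Plane) (n : ℕ) : 0 ≤ interferenceTerm Pu α V u γ z n := by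
  refine Set.indicator_nonneg (fun y _ => ?_) _
  have := hγ n
  positivity

theorem summable_interferenceTerm {Pu α : ℝ} (hPu : 0 ≤ Pu) (V : Set Plane) {u : ℕ → Plane}
    {γ : ℕ → ℝ} (hγ : ∀ n, 0 ≤ γ n) {z : Plane}
    (h : ∑' n, ENNReal.ofReal (γ n) * ENNReal.ofReal (‖u n - z‖ ^ (-α)) ≠ ⊤) :
    Summable (interferenceTerm Pu α V u γ z) := by
  refine Summable.of_nonneg_of_le (interferenceTerm_nonneg hPu hγ z) (fun n => ?_)
    ((ENNReal.summable_toReal h).mul_left Pu)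
  have h0 := hγ n
  rw [ENNReal.toReal_mul, ENNReal.toReal_ofReal h0, ENNReal.toReal_ofReal (by positivity)]
  refine Set.indicator_apply_le' (fun _ => ?_) (fun _ => by positivity)
  rw [mul_assoc]

end IsUELayer

/-! ### Lower bound for the Laplace functional of the UEs. -/

/-- Fubini's theorem for a function of two independent random variables. -/
theorem lintegral_indepFun {Ω 𝓧 𝓨 : Type*} [MeasurableSpace Ω] [MeasurableSpace 𝓧]
    [MeasurableSpace 𝓨] {P : Measure Ω} [IsProbabilityMeasure P] {X : Ω → 𝓧} {Y : Ω → 𝓨}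
    (h : IndepFun X Y P) (hX : Measurable X) (hY : Measurable Y) {F : 𝓧 × 𝓨 → ℝ≥0∞}
    (hF : Measurable F) :
    ∫⁻ ω, F (X ω, Y ω) ∂P = ∫⁻ ω, ∫⁻ ω', F (X ω, Y ω') ∂P ∂P := by
  have hlaw := (indepFun_iff_map_prod_eq_prod_map_map hX.aemeasurable hY.aemeasurable).1 h
  have := Measure.isProbabilityMeasure_map (μ := P) hY.aemeasurable
  rw [← lintegral_map hF (hX.prodMk hY), hlaw, lintegral_prod _ hF.aemeasurable,
    lintegral_map hF.lintegral_prod_right' hX]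
  exact lintegral_congr fun ω => lintegral_map (hF.comp measurable_prodMk_left) hY

theorem card_filter_le_encard {U : ℕ → Plane} (hU : Function.Injective U) (B : Set Plane)
    [DecidablePred (· ∈ B)] (N : ℕ) :
    (((Finset.range N).filter fun n => U n ∈ B).card : ℕ∞) ≤ (Set.range U ∩ B).encard := by
  rw [← Set.encard_coe_eq_coe_finsetCard, ← hU.encard_image]
  refine Set.encard_le_encard ?_
  rintro _ ⟨n, hn, rfl⟩
  exact ⟨⟨n, rfl⟩, (Finset.mem_filter.1 hn).2⟩

-- Among the first N points at most as many fall into each set as among all points, and factors in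
-- [0, 1] can only decrease a product.
open Classical in
theorem prod_pow_encard_le {U : ℕ → Plane} (hU : Function.Injective U) {m : ℕ}
    (B : Fin m → Set Plane) (hfin : ∀ i, (Set.range U ∩ B i).Finite) {a : Fin m → ℝ}
    (ha0 : ∀ i, 0 ≤ a i) (ha1 : ∀ i, a i ≤ 1) (N : ℕ) :
    ∏ i, a i ^ (Set.range U ∩ B i).encard.toNat ≤
      ∏ n ∈ Finset.range N, ∏ i, if U n ∈ B i then a i else 1 := by
  rw [Finset.prod_comm]
  refine Finset.prod_le_prod (fun i _ => pow_nonneg (ha0 i) _) fun i _ => ?_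
  rw [Finset.prod_ite, Finset.prod_const, Finset.prod_const_one, mul_one]
  refine pow_le_pow_of_le_one (ha0 i) (ha1 i) ?_
  have h1 := card_filter_le_encard hU (B i) N
  exact (ENat.toNat_natCast _).symm.le.trans
    (ENat.toNat_le_toNat h1 (Set.encard_lt_top_iff.2 (hfin i)).ne)

namespace IsHPPP

variable {Ω : Type*} [MeasurableSpace Ω] {P : Measure Ω} {lam : ℝ} {Φ : Ω → Set Plane}

theorem lintegral_prod_pow_count (h : IsHPPP P lam Φ) (hlam : 0 ≤ lam) {m : ℕ}
    {B : Fin m → Set Plane} (hB : ∀ i, MeasurableSet (B i))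
    (hdisj : Pairwise fun i j => Disjoint (B i) (B j)) (hfin : ∀ i, volume (B i) < ⊤)
    {a : Fin m → ℝ} (ha : ∀ i, 0 ≤ a i) :
    ∫⁻ ω, ENNReal.ofReal (∏ i, a i ^ (Φ ω ∩ B i).encard.toNat) ∂P =
      ENNReal.ofReal (Real.exp (-(lam * ∑ i, (volume (B i)).toReal * (1 - a i)))) := by
  have h1 : iIndepFun (fun i ω => ENNReal.ofReal (a i ^ (Φ ω ∩ B i).encard.toNat)) P :=
    (h.indep_count m B hB hdisj).comp (fun i (n : ℕ∞) => ENNReal.ofReal (a i ^ n.toNat))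
      (fun _ => .of_discrete)
  have h2 : ∀ i, Measurable fun ω => ENNReal.ofReal (a i ^ (Φ ω ∩ B i).encard.toNat) := fun i =>
    Measurable.comp (g := fun n : ℕ∞ => ENNReal.ofReal (a i ^ n.toNat)) .of_discrete
      (h.measurable_count _ (hB i))
  simp_rw [fun ω => ENNReal.ofReal_prod_of_nonneg
    (fun i (_ : i ∈ Finset.univ) => pow_nonneg (ha i) (Φ ω ∩ B i).encard.toNat)]
  rw [lintegral_prod_eq_prod_lintegral_of_indepFun _ _ h1 h2]
  simp_rw [fun i => h.lintegral_pow_count hlam (hB i) (hfin i) (ha i)]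
  rw [← ENNReal.ofReal_prod_of_nonneg (fun i _ => (Real.exp_pos _).le), ← Real.exp_sum,
    Finset.sum_neg_distrib, Finset.mul_sum]
  simp_rw [mul_assoc]

end IsHPPP

section Levels

variable {u : Plane → ℝ}

/-- The set where `k * u` has integer part `i + 1`. -/
def levelSet (u : Plane → ℝ) (k : ℕ) (i : Fin k) : Set Plane := {y | ⌊u y * k⌋₊ = (i : ℕ) + 1}

theorem measurableSet_levelSet (hu : Measurable u) (k : ℕ) (i : Fin k) :
    MeasurableSet (levelSet u k i) :=
  (Nat.measurable_floor.comp (hu.mul_const (k : ℝ))) (measurableSet_singleton ((i : ℕ) + 1))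

theorem disjoint_levelSet (u : Plane → ℝ) (k : ℕ) :
    Pairwise fun i j => Disjoint (levelSet u k i) (levelSet u k j) := by
  intro i j hij
  refine Set.disjoint_left.2 fun y hi hj => hij (Fin.ext ?_)
  have : (i : ℕ) + 1 = j + 1 := Eq.trans (Eq.symm hi) hj
  omega

-- The value i + 1 on `levelSet u k i` skips level 0, which contributes the factor 1 and may have
-- infinite area.
open Classical in
theorem prod_levelSet (hu1 : ∀ y, u y ≤ 1) (k : ℕ) (y : Plane) :
    (∏ i, if y ∈ levelSet u k i then 1 - ((i : ℕ) + 1 : ℝ) / k else 1) =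
      1 - (⌊u y * k⌋₊ : ℝ) / k := by
  have hle : ⌊u y * k⌋₊ ≤ k := by
    refine Nat.floor_le_of_le ?_
    have := hu1 y
    have : (0 : ℝ) ≤ k := by positivity
    nlinarith
  rcases Nat.eq_zero_or_pos ⌊u y * k⌋₊ with h0 | hpos
  · rw [Finset.prod_eq_one]
    · simp [h0]
    · intro i _
      refine if_neg fun hi => ?_
      have : ⌊u y * k⌋₊ = (i : ℕ) + 1 := hi
      omega
  · have hlt : ⌊u y * k⌋₊ - 1 < k := by omega
    rw [Finset.prod_eq_single ⟨⌊u y * k⌋₊ - 1, hlt⟩]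
    · have hmem : y ∈ levelSet u k ⟨⌊u y * k⌋₊ - 1, hlt⟩ :=
        show ⌊u y * k⌋₊ = (⌊u y * k⌋₊ - 1) + 1 by omega
      rw [if_pos hmem]
      congr 2
      have : ((⌊u y * k⌋₊ - 1 : ℕ) : ℝ) + 1 = ((⌊u y * k⌋₊ - 1 + 1 : ℕ) : ℝ) := by push_cast; ring
      rw [this]
      congr 1
      omega
    · intro i _ hi
      refine if_neg fun hmem => hi (Fin.ext ?_)
      have : ⌊u y * k⌋₊ = (i : ℕ) + 1 := hmem
      change (i : ℕ) = ⌊u y * k⌋₊ - 1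
      omega
    · intro h
      exact absurd (Finset.mem_univ _) h

theorem sum_levelSet_le (hu : Measurable u) (hu0 : ∀ y, 0 ≤ u y) (k : ℕ) :
    ∑ i : Fin k, volume (levelSet u k i) * ENNReal.ofReal (((i : ℕ) + 1 : ℝ) / k) ≤
      ∫⁻ y, ENNReal.ofReal (u y) := by
  have h1 : ∀ i : Fin k, volume (levelSet u k i) * ENNReal.ofReal (((i : ℕ) + 1 : ℝ) / k) ≤
      ∫⁻ y in levelSet u k i, ENNReal.ofReal (u y) := by
    intro i
    rw [mul_comm, ← setLIntegral_const]
    refine setLIntegral_mono hu.ennreal_ofReal fun y hy => ENNReal.ofReal_le_ofReal ?_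
    have hk : (0 : ℝ) < k := by exact_mod_cast i.pos
    have hfl : ⌊u y * k⌋₊ = (i : ℕ) + 1 := hy
    have h2 := Nat.floor_le (a := u y * k) (mul_nonneg (hu0 y) hk.le)
    rw [div_le_iff₀ hk]
    rw [hfl] at h2
    exact_mod_cast h2
  refine (Finset.sum_le_sum fun i _ => h1 i).trans ?_
  rw [← tsum_fintype (L := .unconditional _), ← lintegral_iUnion (measurableSet_levelSet hu k)
    (disjoint_levelSet u k)]
  exact setLIntegral_le_lintegral _ _

end Levels

namespace IsUELayer

variable {Ω : Type*} [MeasurableSpace Ω] {P : Measure Ω} {Φa : Ω → Set Plane} {lamU : ℝ}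
  {U : ℕ → Ω → Plane} {g : ℕ → Ω → ℝ}

/-- Rounding u down to multiples of 1/k leaves a step function on disjoint sets, for which
independent Poisson counts give the Laplace functional exactly. Rounding down decreases the integral
of u and truncating to N points increases the product, so both errors go in the favourable
direction. -/
theorem exp_le_lintegral_prod_floor (h : IsUELayer P Φa lamU U g) (hlamU : 0 ≤ lamU)
    {u : Plane → ℝ} (hu : Measurable u) (hu0 : ∀ y, 0 ≤ u y) (hu1 : ∀ y, u y ≤ 1)
    (hfin : ∫⁻ y, ENNReal.ofReal (u y) < ⊤) (N k : ℕ) :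
    ENNReal.ofReal (Real.exp (-(lamU * (∫⁻ y, ENNReal.ofReal (u y)).toReal))) ≤
      ∫⁻ ω, ENNReal.ofReal (∏ n ∈ Finset.range N, (1 - (⌊u (U n ω) * k⌋₊ : ℝ) / k)) ∂P := by
  classical
  set a : Fin k → ℝ := fun i => 1 - ((i : ℕ) + 1 : ℝ) / k with ha
  have hai : ∀ i : Fin k, ((i : ℕ) + 1 : ℝ) / k ≤ 1 := by
    intro i
    refine div_le_one_of_le₀ ?_ (by positivity)
    exact_mod_cast i.2
  have ha0 : ∀ i, 0 ≤ a i := fun i => sub_nonneg.2 (hai i)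
  have ha1 : ∀ i, a i ≤ 1 := fun i => sub_le_self _ (by positivity)
  have hsum := sum_levelSet_le hu hu0 k
  -- As in Markov's inequality: u is at least a positive constant on each level set and has finite
  -- integral.
  have hvol : ∀ i : Fin k, volume (levelSet u k i) < ⊤ := by
    intro i
    have h1 : volume (levelSet u k i) * ENNReal.ofReal (((i : ℕ) + 1 : ℝ) / k) < ⊤ :=
      ((Finset.single_le_sum (f := fun i : Fin k => volume (levelSet u k i) *
        ENNReal.ofReal (((i : ℕ) + 1 : ℝ) / k)) (fun i _ => zero_le)
        (Finset.mem_univ i)).trans hsum).trans_lt hfin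
    by_contra htop
    rw [not_lt, top_le_iff] at htop
    have hk : (0 : ℝ) < k := by exact_mod_cast i.pos
    rw [htop, ENNReal.top_mul (by rw [Ne, ENNReal.ofReal_eq_zero, not_le]; positivity)] at h1
    exact lt_irrefl _ h1
  have hmain := h.poisson.lintegral_prod_pow_count hlamU (measurableSet_levelSet hu k)
    (disjoint_levelSet u k) hvol ha0
  have hle : ∑ i, (volume (levelSet u k i)).toReal * (1 - a i) ≤
      (∫⁻ y, ENNReal.ofReal (u y)).toReal := by
    refine le_trans (le_of_eq ?_) (ENNReal.toReal_mono hfin.ne hsum)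
    rw [ENNReal.toReal_sum fun i _ => ENNReal.mul_ne_top (hvol i).ne ENNReal.ofReal_ne_top]
    refine Finset.sum_congr rfl fun i _ => ?_
    rw [ENNReal.toReal_mul, ENNReal.toReal_ofReal (by positivity), ha, sub_sub_cancel]
  calc _ ≤ ENNReal.ofReal
        (Real.exp (-(lamU * ∑ i, (volume (levelSet u k i)).toReal * (1 - a i)))) := by
        refine ENNReal.ofReal_le_ofReal (Real.exp_le_exp.2 (neg_le_neg ?_))
        exact mul_le_mul_of_nonneg_left hle hlamU
    _ = _ := hmain.symm
    _ ≤ _ := by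
        refine lintegral_mono_ae ?_
        have hf : ∀ᵐ ω ∂P, ∀ i, (Set.range (fun n => U n ω) ∩ levelSet u k i).Finite :=
          ae_all_iff.2 fun i => h.poisson.ae_finite (measurableSet_levelSet hu k i) (hvol i)
        filter_upwards [hf, h.distinct] with ω h1 h2
        refine ENNReal.ofReal_le_ofReal ((prod_pow_encard_le h2 _ h1 ha0 ha1 N).trans_eq ?_)
        exact Finset.prod_congr rfl fun n _ => prod_levelSet hu1 k (U n ω)

/-- The lower bound for the Laplace functional of a Poisson process, for finitely many points. -/
theorem exp_le_lintegral_prod [IsProbabilityMeasure P] (h : IsUELayer P Φa lamU U g)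
    (hlamU : 0 ≤ lamU) {u : Plane → ℝ} (hu : Measurable u) (hu0 : ∀ y, 0 ≤ u y)
    (hu1 : ∀ y, u y ≤ 1) (hfin : ∫⁻ y, ENNReal.ofReal (u y) < ⊤) (N : ℕ) :
    ENNReal.ofReal (Real.exp (-(lamU * (∫⁻ y, ENNReal.ofReal (u y)).toReal))) ≤
      ∫⁻ ω, ENNReal.ofReal (∏ n ∈ Finset.range N, (1 - u (U n ω))) ∂P := by
  -- N is fixed and k tends to infinity: the rounded values tend to u and all products stay in [0,
  -- 1].
  refine ge_of_tendsto' (x := atTop) (f := fun k : ℕ => ∫⁻ ω, ENNReal.ofReal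
    (∏ n ∈ Finset.range N, (1 - (⌊u (U n ω) * k⌋₊ : ℝ) / k)) ∂P) ?_
    (h.exp_le_lintegral_prod_floor hlamU hu hu0 hu1 hfin N)
  refine tendsto_lintegral_of_dominated_convergence (bound := fun _ => 1) (fun k => ?_)
    (fun k => ae_of_all _ fun ω => ?_) (by simp) (ae_of_all _ fun ω => ?_)
  · refine (Finset.measurable_prod _ fun n _ => ?_).ennreal_ofReal
    have h1 : Measurable fun ω => u (U n ω) * k :=
      (hu.comp (h.measurable_position n)).mul_const _
    exact ((measurable_of_countable (fun m : ℕ => (m : ℝ))).comp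
      (Nat.measurable_floor.comp h1)).div_const _ |>.const_sub _
  · refine ENNReal.ofReal_le_one.2 (Finset.prod_le_one (fun n _ => ?_) fun n _ => ?_)
    · rw [sub_nonneg]
      refine div_le_one_of_le₀ ?_ (by positivity)
      refine (Nat.floor_le (mul_nonneg (hu0 _) (by positivity))).trans ?_
      exact mul_le_of_le_one_left (by positivity) (hu1 _)
    · exact sub_le_self _ (by positivity)
  · refine (ENNReal.continuous_ofReal.tendsto _).comp (tendsto_finsetProd _ fun n _ => ?_)
    exact ((tendsto_nat_floor_mul_div_atTop (hu0 (U n ω))).comp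
      tendsto_natCast_atTop_atTop).const_sub 1

/-- Averaging over the gains with frozen positions: each contributes 1 / (1 + t) = 1 - γ(t). -/
theorem lintegral_prod_exp_gain (h : IsUELayer P Φa lamU U g) {t : ℕ → ℝ}
    (ht : ∀ n, 0 ≤ t n) (N : ℕ) :
    ∫⁻ ω, ENNReal.ofReal (∏ n ∈ Finset.range N, Real.exp (-(t n * g n ω))) ∂P =
      ENNReal.ofReal (∏ n ∈ Finset.range N, (1 - gammaFun (t n))) := by
  simp_rw [fun ω => ENNReal.ofReal_prod_of_nonneg
    (fun n (_ : n ∈ Finset.range N) => (Real.exp_pos (-(t n * g n ω))).le)]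
  have hm : ∀ n, Measurable fun x : ℝ => ENNReal.ofReal (Real.exp (-(t n * x))) := fun n => by
    fun_prop
  rw [lintegral_prod_eq_prod_lintegral_of_indepFun (Finset.range N)
    (fun n ω => ENNReal.ofReal (Real.exp (-(t n * g n ω))))
    (h.indep_gain.comp (fun n (x : ℝ) => ENNReal.ofReal (Real.exp (-(t n * x)))) hm)
    (fun n => (hm n).comp (h.measurable_gain n)),
    ENNReal.ofReal_prod_of_nonneg (fun n _ => sub_nonneg.2 (gammaFun_le_one (ht n)))]
  refine Finset.prod_congr rfl fun n _ => ?_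
  rw [h.lintegral_gain n (hm n), expMeasure_laplace (ht n), gammaFun, sub_sub_cancel]

theorem indepFun_position_gain (h : IsUELayer P Φa lamU U g) :
    IndepFun (fun ω n => U n ω) (fun ω n => g n ω) P := by
  rw [IndepFun_iff_Indep]
  refine (indep_of_indep_of_le h.indep_gain_position ?_ (le_sup_of_le_right ?_)).symm
  all_goals
    rw [MeasurableSpace.pi, MeasurableSpace.comap_iSup]
    simp_rw [MeasurableSpace.comap_comp]
    exact le_rfl

/-- The lower bound for the Laplace transform of the interference with a deterministic guard
region. -/
theorem exp_le_lintegral_interference [IsProbabilityMeasure P] (h : IsUELayer P Φa lamU U g)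
    (hlamU : 0 ≤ lamU) {Pu α s : ℝ} (hPu : 0 ≤ Pu) (hα : 2 < α) (hs : 0 ≤ s) {V : Set Plane}
    (hV : MeasurableSet V) (z : Plane) :
    ENNReal.ofReal (Real.exp (-(lamU * (∫⁻ y in Vᶜ, ENNReal.ofReal
        (gammaFun (s * Pu * ‖y - z‖ ^ (-α)))).toReal))) ≤
      ∫⁻ ω, ENNReal.ofReal (Real.exp (-s * interference Pu α V (fun n => U n ω) (fun n => g n ω) z))
        ∂P := by
  -- Setting t to 0 on V encodes the guard region, since γ(0) = 0.
  set t : Plane → ℝ := Vᶜ.indicator fun y => s * Pu * ‖y - z‖ ^ (-α) with ht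
  have ht0 : ∀ y, 0 ≤ t y := fun y => Set.indicator_nonneg (fun y _ => by positivity) y
  have htm : Measurable t := by
    refine Measurable.indicator ?_ hV.compl
    fun_prop
  have hγ : ∀ y, ENNReal.ofReal (gammaFun (t y)) = Vᶜ.indicator
      (fun y => ENNReal.ofReal (gammaFun (s * Pu * ‖y - z‖ ^ (-α)))) y := by
    intro y
    by_cases hy : y ∈ Vᶜ
    · simp only [ht, Set.indicator_of_mem hy]
    · simp only [ht, Set.indicator_of_notMem hy]
      simp [gammaFun]
  have hI : ∫⁻ y in Vᶜ, ENNReal.ofReal (gammaFun (s * Pu * ‖y - z‖ ^ (-α))) =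
      ∫⁻ y, ENNReal.ofReal (gammaFun (t y)) := by
    rw [← lintegral_indicator hV.compl]
    exact lintegral_congr fun y => (hγ y).symm
  have hfin : ∫⁻ y, ENNReal.ofReal (gammaFun (t y)) < ⊤ := by
    rw [← hI]
    exact (setLIntegral_le_lintegral _ _).trans_lt
      (lintegral_gammaFun_lt_top hα (mul_nonneg hs hPu) z)
  rw [hI]
  have hterm : ∀ ω n, s * interferenceTerm Pu α V (fun n => U n ω) (fun n => g n ω) z n =
      t (U n ω) * g n ω := by
    intro ω n
    by_cases hy : U n ω ∈ Vᶜ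
    · simp only [ht, interferenceTerm, Set.indicator_of_mem hy]
      ring
    · simp only [ht, interferenceTerm, Set.indicator_of_notMem hy]
      ring
  have hN : ∀ N, ∫⁻ ω, ENNReal.ofReal (∏ n ∈ Finset.range N, Real.exp (-(t (U n ω) * g n ω))) ∂P =
      ∫⁻ ω, ENNReal.ofReal (∏ n ∈ Finset.range N, (1 - gammaFun (t (U n ω)))) ∂P := by
    intro N
    have hUm : Measurable fun ω n => U n ω := measurable_pi_lambda _ h.measurable_position
    have hgm : Measurable fun ω n => g n ω := measurable_pi_lambda _ h.measurable_gain
    have hFm : Measurable fun p : (ℕ → Plane) × (ℕ → ℝ) =>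
        ENNReal.ofReal (∏ n ∈ Finset.range N, Real.exp (-(t (p.1 n) * p.2 n))) := by
      refine (Finset.measurable_prod _ fun n _ => ?_).ennreal_ofReal
      refine Real.measurable_exp.comp (Measurable.neg ?_)
      exact (htm.comp ((measurable_pi_apply n).comp measurable_fst)).mul
        ((measurable_pi_apply n).comp measurable_snd)
    rw [lintegral_indepFun h.indepFun_position_gain hUm hgm hFm]
    exact lintegral_congr fun ω => h.lintegral_prod_exp_gain (fun n => ht0 (U n ω)) N
  -- The lower bound does not depend on N, and almost sure summability of the interference makes the
  -- partial products converge to the exponential of the whole sum.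
  refine ge_of_tendsto' (x := atTop) (f := fun N : ℕ => ∫⁻ ω, ENNReal.ofReal
    (∏ n ∈ Finset.range N, Real.exp (-(t (U n ω) * g n ω))) ∂P) ?_ fun N => ?_
  · refine tendsto_lintegral_of_dominated_convergence' (bound := fun _ => 1) (fun N => ?_)
      (fun N => ?_) (by simp) ?_
    · refine (Measurable.ennreal_ofReal (Finset.measurable_prod _ fun n _ => ?_)).aemeasurable
      exact Real.measurable_exp.comp
        ((htm.comp (h.measurable_position n)).mul (h.measurable_gain n)).neg
    · filter_upwards [h.ae_gain_nonneg] with ω hω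
      refine ENNReal.ofReal_le_one.2 (Finset.prod_le_one (fun n _ => (Real.exp_pos _).le)
        fun n _ => ?_)
      rw [Real.exp_le_one_iff, neg_nonpos]
      exact mul_nonneg (ht0 _) (hω n)
    · filter_upwards [h.ae_gain_nonneg, h.ae_tsum_ne_top hα z] with ω h1 h2
      have hsum := (summable_interferenceTerm hPu V h1 h2).hasSum.tendsto_sum_nat
      have hlim := (Real.continuous_exp.tendsto _).comp (hsum.const_mul (-s))
      refine (ENNReal.continuous_ofReal.tendsto _).comp (hlim.congr fun N => ?_)
      change Real.exp (-s * ∑ n ∈ Finset.range N, _) = _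
      rw [← Real.exp_sum, Finset.mul_sum]
      congr 1
      refine Finset.sum_congr rfl fun n _ => ?_
      rw [neg_mul, hterm]
  · rw [hN]
    exact h.exp_le_lintegral_prod hlamU (measurable_gammaFun.comp htm)
      (fun y => gammaFun_nonneg (ht0 y)) (fun y => gammaFun_le_one (ht0 y)) hfin N

end IsUELayer

/-! ### The radial formula in polar coordinates. -/

section Polar

theorem norm_polarPoint {r : ℝ} (hr : 0 ≤ r) (θ : ℝ) : ‖polarPoint r θ‖ = r := by
  rw [polarPoint, EuclideanSpace.norm_eq, Fin.sum_univ_two]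
  simp only [Real.norm_eq_abs, sq_abs, Matrix.cons_val_zero, Matrix.cons_val_one]
  rw [show (r * Real.cos θ) ^ 2 + (r * Real.sin θ) ^ 2 =
    r ^ 2 * (Real.cos θ ^ 2 + Real.sin θ ^ 2) by ring, Real.cos_sq_add_sin_sq, mul_one,
    Real.sqrt_sq hr]

theorem measurePreserving_plane :
    MeasurePreserving (fun p : ℝ × ℝ => (!₂[p.1, p.2] : Plane)) volume volume :=
  (PiLp.volume_preserving_toLp (Fin 2)).comp ((volume_preserving_finTwoArrow ℝ).symm)

theorem measurable_polarPoint : Measurable fun p : ℝ × ℝ => polarPoint p.1 p.2 :=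
  measurePreserving_plane.measurable.comp
    (f := fun p : ℝ × ℝ => (p.1 * Real.cos p.2, p.1 * Real.sin p.2)) (by fun_prop)

theorem lintegral_plane_polar {f : Plane → ℝ≥0∞} (hf : Measurable f) :
    ∫⁻ y, f y = ∫⁻ r in Set.Ioi (0 : ℝ), ∫⁻ θ in Set.Ioo (-Real.pi) Real.pi,
      ENNReal.ofReal r * f (polarPoint r θ) := by
  rw [← measurePreserving_plane.lintegral_comp hf, ← lintegral_comp_polarCoord_symm,
    polarCoord_target, Measure.volume_eq_prod, ← Measure.prod_restrict]
  have hm : Measurable fun p : ℝ × ℝ => ENNReal.ofReal p.1 * f (polarPoint p.1 p.2) :=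
    (measurable_fst.ennreal_ofReal).mul (hf.comp measurable_polarPoint)
  refine Eq.trans (lintegral_congr fun p => ?_) (lintegral_prod _ hm.aemeasurable)
  rw [polarCoord_symm_apply, smul_eq_mul]
  rfl

/-- The radial formula as an integral over the plane. -/
theorem radialLaplace_eq {lamA : ℝ} (hlamA : 0 ≤ lamA) (lamU : ℝ) {Pw α s : ℝ} (hPw : 0 ≤ Pw)
    (hs : 0 ≤ s) (z c : Plane) :
    radialLaplace Pw α (equivDensity lamA lamU z c) s = Real.exp (-(lamU * (∫⁻ y : Plane,
      ENNReal.ofReal ((1 - pca lamA y c) * gammaFun (s * Pw * ‖y - z‖ ^ (-α)))).toReal)) := by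
  set F : Plane → ℝ := fun y => (1 - pca lamA (y + z) c) * gammaFun (s * Pw * ‖y‖ ^ (-α)) with hF
  have hpm : Measurable fun y : Plane => pca lamA (y + z) c :=
    measurable_pca_comp lamA (measurable_add_const z) measurable_const
  have hFm : Measurable F := by
    refine (hpm.const_sub 1).mul (measurable_gammaFun.comp ?_)
    fun_prop
  have hp0 : ∀ y, 0 ≤ 1 - pca lamA (y + z) c := fun y => sub_nonneg.2 (pca_le_one hlamA _ _)
  have hF0 : ∀ y, 0 ≤ F y := fun y => mul_nonneg (hp0 y) (gammaFun_nonneg (by positivity))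
  have htrans : ∫⁻ y : Plane, ENNReal.ofReal
      ((1 - pca lamA y c) * gammaFun (s * Pw * ‖y - z‖ ^ (-α))) =
      ∫⁻ y, ENNReal.ofReal (F y) := by
    rw [← lintegral_sub_right_eq_self (fun y => ENNReal.ofReal (F y)) z]
    simp [hF]
  have hpθ : ∀ r, Measurable fun θ => pca lamA (polarPoint r θ + z) c := fun r =>
    hpm.comp (measurable_polarPoint.comp measurable_prodMk_left)
  have hint : ∀ r, Integrable (fun θ => pca lamA (polarPoint r θ + z) c)
      (volume.restrict (Set.Ioo (-Real.pi) Real.pi)) := fun r =>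
    Integrable.of_bound (hpθ r).aestronglyMeasurable 1 (ae_of_all _ fun θ => by
      rw [Real.norm_eq_abs, abs_of_pos (pca_pos _ _ _)]
      exact pca_le_one hlamA _ _)
  -- Periodicity moves the angle to the range (-π, π) used by `polarCoord`.
  have hangle : ∀ r, ∫ θ in (0 : ℝ)..(2 * Real.pi), pca lamA (polarPoint r θ + z) c =
      ∫ θ in Set.Ioo (-Real.pi) Real.pi, pca lamA (polarPoint r θ + z) c := by
    intro r
    have hper : Function.Periodic (fun θ => pca lamA (polarPoint r θ + z) c) (2 * Real.pi) := by
      intro θ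
      simp only [polarPoint, Real.cos_add_two_pi, Real.sin_add_two_pi]
    have h1 := hper.intervalIntegral_add_eq 0 (-Real.pi)
    rw [zero_add, show -Real.pi + 2 * Real.pi = Real.pi by ring] at h1
    rw [h1, intervalIntegral.integral_of_le (by linarith [Real.pi_pos]),
      integral_Ioc_eq_integral_Ioo]
  -- The factor γ is constant on the circle of radius r, so the angular integral acts on 1 - p_c
  -- alone and produces the radial density.
  have hH : ∀ r ∈ Set.Ioi (0 : ℝ),
      2 * Real.pi * (equivDensity lamA lamU z c r * r * gammaFun (s * Pw * r ^ (-α))) =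
      lamU * ∫ θ in Set.Ioo (-Real.pi) Real.pi, r * F (polarPoint r θ) := by
    intro r hr
    have hr0 : 0 ≤ r := le_of_lt hr
    simp only [hF, norm_polarPoint hr0]
    rw [integral_const_mul, integral_mul_const, integral_sub (integrable_const _) (hint r),
      integral_const, measureReal_restrict_apply_univ, Real.volume_real_Ioo_of_le
        (by linarith [Real.pi_pos]), equivDensity, hangle]
    have := Real.pi_pos
    rw [smul_eq_mul]
    field_simp
    ring
  rw [radialLaplace, htrans]
  congr 1
  rw [neg_mul, ← integral_const_mul, setIntegral_congr_fun measurableSet_Ioi hH,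
    integral_const_mul]
  congr 2
  have hFp : Measurable fun p : ℝ × ℝ => p.1 * F (polarPoint p.1 p.2) :=
    measurable_fst.mul (hFm.comp measurable_polarPoint)
  -- No integrability is needed: if the integral is infinite, both sides take the default value 0.
  rw [integral_eq_lintegral_of_nonneg_ae, lintegral_plane_polar hFm.ennreal_ofReal]
  · congr 1
    refine setLIntegral_congr_fun measurableSet_Ioi fun r hr => ?_
    have hr0 : 0 ≤ r := le_of_lt hr
    rw [ofReal_integral_eq_lintegral_ofReal]
    · exact lintegral_congr fun θ => ENNReal.ofReal_mul hr0
    · simp only [hF, norm_polarPoint hr0]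
      exact (((integrable_const _).sub (hint r)).mul_const _).const_mul _
    · exact ae_of_all _ fun θ => mul_nonneg hr0 (hF0 _)
  · filter_upwards [ae_restrict_mem measurableSet_Ioi] with r hr
    exact integral_nonneg fun θ => mul_nonneg (le_of_lt hr) (hF0 _)
  · exact (hFp.stronglyMeasurable.integral_prod_right).aestronglyMeasurable

end Polar

/-! ### A jointly measurable Voronoi cell. -/

section RegularVoronoi

/-- A jointly measurable version of the Voronoi cell. -/
def regularVoronoi (S : Set Plane) (c : Plane) : Set Plane :=
  {x | ∃ (i : ℕ) (q : ℚ), ‖x - c‖ + ‖x - denseSeq Plane i‖ < q ∧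
    (S ∩ Metric.ball (denseSeq Plane i) (q : ℝ)).encard ≤ 1}

/-- A ball as in `regularVoronoi` contains c and every y at least as close to x as c, so holding at
most one point of S means that c is the strict nearest point to x. Conversely, local finiteness
leaves room for such a ball with centre in a countable dense set and rational radius. -/
theorem LocallyFinite.voronoiCell_eq {S : Set Plane} (hS : LocallyFinite S) {c : Plane}
    (hc : c ∈ S) : voronoiCell S c = regularVoronoi S c := by
  ext x
  constructor
  · intro hx
    obtain ⟨ε, hε, hgap⟩ := hS.exists_gap (x := x) (r := ‖x - c‖) (F := {c}) hx
    -- A point in the ball is within ‖x - c‖ + 2(ε/4) + ε/4 of x, hence inside the gap ε.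
    obtain ⟨i, hi⟩ := (denseRange_denseSeq Plane).exists_dist_lt x (show 0 < ε / 4 by linarith)
    rw [dist_eq_norm] at hi
    obtain ⟨q, hq1, hq2⟩ := exists_rat_btwn
      (show ‖x - c‖ + ‖x - denseSeq Plane i‖ < ‖x - c‖ + ‖x - denseSeq Plane i‖ + ε / 4 by linarith)
    refine ⟨i, q, hq1, (Set.encard_le_encard (t := {c}) ?_).trans (Set.encard_singleton c).le⟩
    rintro y ⟨hyS, hyq⟩
    by_contra hyc
    have h1 := hgap y ⟨hyS, hyc⟩
    have h2 := norm_sub_le_norm_sub_add_norm_sub x (denseSeq Plane i) y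
    rw [Metric.mem_ball, dist_eq_norm, norm_sub_rev] at hyq
    linarith
  · rintro ⟨i, q, hq, hcard⟩ y hy
    by_contra hneg
    rw [not_lt] at hneg
    have h1 := norm_sub_le_norm_sub_add_norm_sub c x (denseSeq Plane i)
    have h2 := norm_sub_le_norm_sub_add_norm_sub y x (denseSeq Plane i)
    rw [norm_sub_rev c x] at h1
    rw [norm_sub_rev y x] at h2
    refine hy.2 (Set.encard_le_one_iff.1 hcard y c ⟨hy.1, ?_⟩ ⟨hc, ?_⟩)
    · rw [Metric.mem_ball, dist_eq_norm]
      linarith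
    · rw [Metric.mem_ball, dist_eq_norm]
      linarith

theorem measurableSet_regularVoronoi {T : Set Plane → Plane} (hT : Measurable (α := Config) T) :
    MeasurableSet {p : Config × Plane | p.2 ∈ regularVoronoi p.1 (T p.1)} := by
  have e : {p : Config × Plane | p.2 ∈ regularVoronoi p.1 (T p.1)} =
      ⋃ (i : ℕ) (q : ℚ), {p : Config × Plane | ‖p.2 - T p.1‖ + ‖p.2 - denseSeq Plane i‖ < q} ∩
        Prod.fst ⁻¹' {S : Config | Set.encard ((S : Set Plane) ∩
          Metric.ball (denseSeq Plane i) (q : ℝ)) ∈ Set.Iic 1} := by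
    ext p
    constructor
    · rintro ⟨i, q, h1, h2⟩
      exact Set.mem_iUnion₂.2 ⟨i, q, h1, h2⟩
    · intro h
      obtain ⟨i, q, h1, h2⟩ := Set.mem_iUnion₂.1 h
      exact ⟨i, q, h1, h2⟩
  rw [e]
  have hTp : Measurable fun p : Config × Plane => T p.1 := hT.comp measurable_fst
  refine MeasurableSet.iUnion fun i => MeasurableSet.iUnion fun q => ?_
  refine (measurableSet_lt ?_ measurable_const).inter
    (measurable_fst (measurable_encard_inter measurableSet_ball .of_discrete))
  exact (measurable_snd.sub hTp).norm.add (measurable_snd.sub_const _).norm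

end RegularVoronoi

/-! ### Independence of the APs and the whole UE layer. -/

/-- A random set of points, as a random element of the space of configurations. -/
def config {Ω : Type*} (Φ : Ω → Set Plane) : Ω → Config := Φ

/-- The layer of UEs: positions and gains. -/
def layer {Ω : Type*} (U : ℕ → Ω → Plane) (g : ℕ → Ω → ℝ) (ω : Ω) : (ℕ → Plane) × (ℕ → ℝ) :=
  (fun n => U n ω, fun n => g n ω)

/-- Associativity of product measures. It turns independence of the gains from APs and positions
together into independence of the APs from positions and gains together. -/
theorem IndepFun.prodMk_right_of_prodMk_left {Ω 𝓧 𝓨 𝓩 : Type*} [MeasurableSpace Ω]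
    [MeasurableSpace 𝓧] [MeasurableSpace 𝓨] [MeasurableSpace 𝓩] {P : Measure Ω}
    [IsProbabilityMeasure P] {X : Ω → 𝓧} {Y : Ω → 𝓨} {Z : Ω → 𝓩} (hX : Measurable X)
    (hY : Measurable Y) (hZ : Measurable Z) (hXY : IndepFun X Y P)
    (hXYZ : IndepFun (fun ω => (X ω, Y ω)) Z P) : IndepFun X (fun ω => (Y ω, Z ω)) P := by
  have iX := Measure.isProbabilityMeasure_map (μ := P) hX.aemeasurable
  have iY := Measure.isProbabilityMeasure_map (μ := P) hY.aemeasurable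
  have iZ := Measure.isProbabilityMeasure_map (μ := P) hZ.aemeasurable
  have h1 := hXY.map_prod_eq_prod_map_map hX.aemeasurable hY.aemeasurable
  have h2 := hXYZ.map_prod_eq_prod_map_map (hX.prodMk hY).aemeasurable hZ.aemeasurable
  have h3 : IndepFun Y Z P := hXYZ.comp (φ := Prod.snd) (ψ := id) measurable_snd measurable_id
  have h4 := h3.map_prod_eq_prod_map_map hY.aemeasurable hZ.aemeasurable
  rw [indepFun_iff_map_prod_eq_prod_map_map hX.aemeasurable (hY.prodMk hZ).aemeasurable, h4,
    ← Measure.prodAssoc_prod, ← h1, ← h2, Measure.map_map MeasurableEquiv.prodAssoc.measurable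
      ((hX.prodMk hY).prodMk hZ)]
  rfl

theorem comap_pi_eq {Ω ι 𝓧 : Type*} [MeasurableSpace 𝓧] (X : ι → Ω → 𝓧) :
    MeasurableSpace.comap (fun ω n => X n ω) inferInstance =
      ⨆ n, MeasurableSpace.comap (X n) inferInstance := by
  rw [MeasurableSpace.pi, MeasurableSpace.comap_iSup]
  simp_rw [MeasurableSpace.comap_comp]
  rfl

namespace IsUELayer

variable {Ω : Type*} [MeasurableSpace Ω] {P : Measure Ω} {Φ : Ω → Set Plane} {lamU : ℝ}
  {U : ℕ → Ω → Plane} {g : ℕ → Ω → ℝ}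

theorem measurable_layer (h : IsUELayer P Φ lamU U g) : Measurable (layer U g) :=
  (measurable_pi_lambda _ h.measurable_position).prodMk (measurable_pi_lambda _ h.measurable_gain)

theorem indepFun_config_layer [IsProbabilityMeasure P] (h : IsUELayer P Φ lamU U g)
    (hΦ : Measurable (config Φ)) : IndepFun (config Φ) (layer U g) P := by
  refine IndepFun.prodMk_right_of_prodMk_left hΦ (measurable_pi_lambda _ h.measurable_position)
    (measurable_pi_lambda _ h.measurable_gain) ?_ ?_
  · rw [IndepFun_iff_Indep, comap_pi_eq]
    exact h.indep_position
  · have e : MeasurableSpace.comap (fun ω => (config Φ ω, fun n => U n ω)) inferInstance =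
        MeasurableSpace.comap Φ configSigma ⊔
          ⨆ n, MeasurableSpace.comap (U n) inferInstance := by
      rw [← comap_pi_eq]
      exact MeasurableSpace.comap_prodMk (config Φ) fun ω n => U n ω
    rw [IndepFun_iff_Indep, comap_pi_eq, e]
    exact h.indep_gain_position.symm

end IsUELayer

/-! ### Averaging over the cell given its centre. -/

section Thinning

variable {Ω : Type*} [MeasurableSpace Ω] {P : Measure Ω} [IsProbabilityMeasure P]

theorem map_restrict_compl {c : Ω → Plane} (hc : Measurable c) {E : Set Ω}
    (hE : NullMeasurableSet E P) {p : Plane → ℝ} (hp : Measurable p) (hp0 : ∀ y, 0 ≤ p y)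
    (hp1 : ∀ y, p y ≤ 1) (h : ∀ A : Set Plane, MeasurableSet A →
      P (c ⁻¹' A ∩ E) = ∫⁻ y in A, ENNReal.ofReal (p y) ∂(P.map c)) :
    (P.restrict Eᶜ).map c = (P.map c).withDensity fun y => ENNReal.ofReal (1 - p y) := by
  ext A hA
  rw [Measure.map_apply hc hA, Measure.restrict_apply (hc hA), withDensity_apply _ hA]
  have h1 := measure_inter_add_sdiff₀ (c ⁻¹' A) hE
  have h2 : ∫⁻ y in A, ENNReal.ofReal (p y) ∂(P.map c) +
      ∫⁻ y in A, ENNReal.ofReal (1 - p y) ∂(P.map c) = P (c ⁻¹' A) := by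
    rw [← lintegral_add_left hp.ennreal_ofReal]
    simp_rw [fun y => (ENNReal.ofReal_add (hp0 y) (sub_nonneg.2 (hp1 y))).symm, add_sub_cancel]
    rw [setLIntegral_const, ENNReal.ofReal_one, one_mul, Measure.map_apply hc hA]
  rw [← h2, h A hA] at h1
  refine (ENNReal.add_right_inj ?_).1 h1
  rw [← h A hA]
  exact measure_ne_top _ _

variable {Φ : Ω → Set Plane} {T : Set Plane → Plane} {lamA : ℝ}

/-- After exchanging the integrals over ω and y, the point y is fixed and lies outside the cell with
conditional probability 1 - p_c(y | centre); then the integrals are exchanged back. Since φ may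
depend on the centre, this expresses a conditional mean given the centre. -/
theorem lintegral_voronoi_compl (hΦ : Measurable (config Φ)) (hT : Measurable (α := Config) T)
    (hlamA : 0 ≤ lamA)
    (hpca : ∀ (x : Plane) (A : Set Plane), MeasurableSet A →
      P ((fun ω => T (Φ ω)) ⁻¹' A ∩ {ω | x ∈ regularVoronoi (Φ ω) (T (Φ ω))}) =
        ∫⁻ y in A, ENNReal.ofReal (pca lamA x y) ∂(P.map fun ω => T (Φ ω)))
    {φ : Plane × Plane → ℝ≥0∞} (hφ : Measurable φ) :
    ∫⁻ ω, (∫⁻ y in (regularVoronoi (Φ ω) (T (Φ ω)))ᶜ, φ (T (Φ ω), y)) ∂P =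
      ∫⁻ ω, (∫⁻ y, φ (T (Φ ω), y) * ENNReal.ofReal (1 - pca lamA y (T (Φ ω)))) ∂P := by
  have hc : Measurable fun ω => T (Φ ω) := hT.comp hΦ
  have hV := measurableSet_regularVoronoi hT
  have hVω : MeasurableSet {q : Ω × Plane | q.2 ∈ regularVoronoi (Φ q.1) (T (Φ q.1))} :=
    hV.preimage (f := fun q : Ω × Plane => (config Φ q.1, q.2))
      ((hΦ.comp measurable_fst).prodMk measurable_snd)
  have hVs : ∀ ω, MeasurableSet (regularVoronoi (Φ ω) (T (Φ ω))) := fun ω =>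
    hVω.preimage (f := fun y => (ω, y)) measurable_prodMk_left
  have hVy : ∀ y, MeasurableSet {ω | y ∈ regularVoronoi (Φ ω) (T (Φ ω))} := fun y =>
    hVω.preimage (f := fun ω => (ω, y)) measurable_prodMk_right
  have hφω : Measurable fun q : Ω × Plane => φ (T (Φ q.1), q.2) :=
    hφ.comp ((hc.comp measurable_fst).prodMk measurable_snd)
  have hpm : ∀ y, Measurable fun c => pca lamA y c := fun y =>
    measurable_pca_comp lamA measurable_const measurable_id
  have hpω : Measurable fun q : Ω × Plane =>
      φ (T (Φ q.1), q.2) * ENNReal.ofReal (1 - pca lamA q.2 (T (Φ q.1))) :=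
    hφω.mul ((measurable_pca_comp lamA
      measurable_snd (hc.comp measurable_fst)).const_sub 1).ennreal_ofReal
  calc ∫⁻ ω, (∫⁻ y in (regularVoronoi (Φ ω) (T (Φ ω)))ᶜ, φ (T (Φ ω), y)) ∂P
      = ∫⁻ ω, (∫⁻ y, {q : Ω × Plane | q.2 ∈ regularVoronoi (Φ q.1) (T (Φ q.1))}ᶜ.indicator
          (fun q => φ (T (Φ q.1), q.2)) (ω, y)) ∂P := by
        refine lintegral_congr fun ω => ?_
        rw [← lintegral_indicator (hVs ω).compl]
        rfl
    _ = ∫⁻ y, (∫⁻ ω, {q : Ω × Plane | q.2 ∈ regularVoronoi (Φ q.1) (T (Φ q.1))}ᶜ.indicator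
          (fun q => φ (T (Φ q.1), q.2)) (ω, y) ∂P) :=
        lintegral_lintegral_swap (hφω.indicator hVω.compl).aemeasurable
    _ = ∫⁻ y, (∫⁻ ω, φ (T (Φ ω), y) * ENNReal.ofReal (1 - pca lamA y (T (Φ ω))) ∂P) := by
        refine lintegral_congr fun y => ?_
        have hφy : Measurable fun c => φ (c, y) := hφ.comp measurable_prodMk_right
        have h1 := map_restrict_compl hc (hVy y).nullMeasurableSet (hpm y)
          (fun c => (pca_pos lamA y c).le) (fun c => pca_le_one hlamA y c) (hpca y)
        have h2 : ∫⁻ ω in {ω | y ∈ regularVoronoi (Φ ω) (T (Φ ω))}ᶜ, φ (T (Φ ω), y) ∂P =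
            ∫⁻ ω, φ (T (Φ ω), y) * ENNReal.ofReal (1 - pca lamA y (T (Φ ω))) ∂P := by
          have hpy : Measurable fun c => ENNReal.ofReal (1 - pca lamA y c) :=
            ((hpm y).const_sub 1).ennreal_ofReal
          rw [← lintegral_map (f := fun c => φ (c, y)) hφy hc, h1,
            lintegral_withDensity_eq_lintegral_mul _ hpy hφy,
            lintegral_map (hpy.mul hφy) hc]
          exact lintegral_congr fun ω => mul_comm _ _
        rw [← h2, ← lintegral_indicator (hVy y).compl]
        rfl
    _ = _ := (lintegral_lintegral_swap hpω.aemeasurable).symm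

end Thinning

/-! ### Measurability of the interference and Laplace bounds given the APs. -/

section Measurability

variable {T : Set Plane → Plane} {xR : Plane → Plane}

theorem measurable_gammaFun_pathLoss (τ α : ℝ) (hxR : Measurable xR) :
    Measurable fun q : Plane × Plane => gammaFun (τ * ‖q.2 - xR q.1‖ ^ (-α)) :=
  measurable_gammaFun.comp
    (((measurable_snd.sub (hxR.comp measurable_fst)).norm.pow_const (-α)).const_mul τ)

theorem measurable_interference (hT : Measurable (α := Config) T) (hxR : Measurable xR)
    (Pu α : ℝ) : Measurable fun q : Config × ((ℕ → Plane) × (ℕ → ℝ)) =>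
      interference Pu α (regularVoronoi q.1 (T q.1)) q.2.1 q.2.2 (xR (T q.1)) := by
  refine Measurable.tsum fun n => ?_
  have hu : Measurable fun q : Config × ((ℕ → Plane) × (ℕ → ℝ)) => q.2.1 n :=
    (measurable_pi_apply n).comp (measurable_fst.comp measurable_snd)
  have hh : Measurable fun q : Config × ((ℕ → Plane) × (ℕ → ℝ)) => q.2.2 n :=
    (measurable_pi_apply n).comp (measurable_snd.comp measurable_snd)
  have hz : Measurable fun q : Config × ((ℕ → Plane) × (ℕ → ℝ)) => xR (T q.1) :=
    hxR.comp (hT.comp measurable_fst)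
  have hV : MeasurableSet {q : Config × ((ℕ → Plane) × (ℕ → ℝ)) |
      q.2.1 n ∈ regularVoronoi q.1 (T q.1)} :=
    (measurableSet_regularVoronoi hT).preimage (f := fun q : Config × ((ℕ → Plane) × (ℕ → ℝ)) =>
      (q.1, q.2.1 n)) (measurable_fst.prodMk hu)
  have hm : Measurable fun q : Config × ((ℕ → Plane) × (ℕ → ℝ)) =>
      Pu * q.2.2 n * ‖q.2.1 n - xR (T q.1)‖ ^ (-α) :=
    (hh.const_mul Pu).mul ((hu.sub hz).norm.pow_const (-α))
  exact hm.indicator hV.compl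

/-- The mean attenuation exponent given the position of the guard region's centre. -/
def meanExponent (lamA τ α : ℝ) (xR : Plane → Plane) (c : Plane) : ℝ≥0∞ :=
  ∫⁻ y : Plane, ENNReal.ofReal ((1 - pca lamA y c) * gammaFun (τ * ‖y - xR c‖ ^ (-α)))

theorem measurable_meanExponent (lamA τ α : ℝ) (hxR : Measurable xR) :
    Measurable (meanExponent lamA τ α xR) := by
  have hm : Measurable fun q : Plane × Plane => ENNReal.ofReal
      ((1 - pca lamA q.2 q.1) * gammaFun (τ * ‖q.2 - xR q.1‖ ^ (-α))) :=
    (((measurable_pca_comp lamA measurable_snd measurable_fst).const_sub 1).mul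
      (measurable_gammaFun_pathLoss τ α hxR)).ennreal_ofReal
  exact hm.lintegral_prod_right'

theorem meanExponent_lt_top {lamA τ α : ℝ} (hτ : 0 ≤ τ) (hα : 2 < α)
    (xR : Plane → Plane) (c : Plane) : meanExponent lamA τ α xR c < ⊤ := by
  refine (lintegral_mono fun y => ENNReal.ofReal_le_ofReal ?_).trans_lt
    (lintegral_gammaFun_lt_top hα hτ (xR c))
  refine mul_le_of_le_one_left (gammaFun_nonneg (by positivity)) ?_
  linarith [pca_pos lamA y c]

theorem measurable_radialLaplace {lamA : ℝ} (hlamA : 0 ≤ lamA) (lamU : ℝ) {Pw α s : ℝ}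
    (hPw : 0 ≤ Pw) (hs : 0 ≤ s) (hxR : Measurable xR) :
    Measurable fun c => radialLaplace Pw α (equivDensity lamA lamU (xR c) c) s := by
  simp_rw [radialLaplace_eq hlamA lamU hPw hs]
  exact Real.measurable_exp.comp
    ((measurable_meanExponent lamA (s * Pw) α hxR).ennreal_toReal.const_mul lamU).neg

end Measurability

namespace IsUELayer

variable {Ω : Type*} [MeasurableSpace Ω] {P : Measure Ω} [IsProbabilityMeasure P]
  {Φ : Ω → Set Plane} {lamA lamU : ℝ} {U : ℕ → Ω → Plane} {g : ℕ → Ω → ℝ}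
  {T : Set Plane → Plane} {xR : Plane → Plane} {Pu α s : ℝ}

/-- For each frozen configuration the receiver is a fixed point and divergence has probability zero;
independence and Fubini's theorem do the rest. -/
theorem ae_tsum_ne_top_of_indep (h : IsUELayer P Φ lamU U g) (hα : 2 < α)
    (hΦ : Measurable (config Φ)) {z : Config → Plane} (hz : Measurable z) :
    ∀ᵐ ω ∂P, ∑' n, ENNReal.ofReal (g n ω) *
      ENNReal.ofReal (‖U n ω - z (config Φ ω)‖ ^ (-α)) ≠ ⊤ := by
  set N : Set (Config × ((ℕ → Plane) × (ℕ → ℝ))) := {q | ∑' n, ENNReal.ofReal (q.2.2 n) *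
    ENNReal.ofReal (‖q.2.1 n - z q.1‖ ^ (-α)) = ⊤} with hN
  have hNm : MeasurableSet N := by
    refine measurableSet_eq_fun (Measurable.tsum fun n => ?_) measurable_const
    have hu : Measurable fun q : Config × ((ℕ → Plane) × (ℕ → ℝ)) => q.2.1 n :=
      (measurable_pi_apply n).comp (measurable_fst.comp measurable_snd)
    have hh : Measurable fun q : Config × ((ℕ → Plane) × (ℕ → ℝ)) => q.2.2 n :=
      (measurable_pi_apply n).comp (measurable_snd.comp measurable_snd)
    exact hh.ennreal_ofReal.mul
      ((hu.sub (hz.comp measurable_fst)).norm.pow_const (-α)).ennreal_ofReal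
  have h1 := lintegral_indepFun (h.indepFun_config_layer hΦ) hΦ h.measurable_layer
    (measurable_one.indicator hNm : Measurable (N.indicator (1 : Config × ((ℕ → Plane) × (ℕ → ℝ)) → ℝ≥0∞)))
  have h2 : ∀ S : Config, ∫⁻ ω, N.indicator (1 : Config × ((ℕ → Plane) × (ℕ → ℝ)) → ℝ≥0∞) (S, layer U g ω) ∂P = 0 := by
    intro S
    refine lintegral_eq_zero_of_ae_eq_zero ?_
    filter_upwards [h.ae_tsum_ne_top hα (z S)] with ω hω
    exact Set.indicator_of_notMem (by exact hω) _
  rw [lintegral_congr fun ω => h2 (config Φ ω), lintegral_zero] at h1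
  filter_upwards [(lintegral_eq_zero_iff (Measurable.comp (measurable_one.indicator hNm)
    (hΦ.prodMk h.measurable_layer))).1 h1] with ω hω htop
  have hmem : (config Φ ω, layer U g ω) ∈ N := htop
  exact one_ne_zero ((Set.indicator_of_mem hmem 1).symm.trans hω)

/-- The conditional Laplace transform of the interference given the APs. -/
theorem setLIntegral_exp_guard_le (h : IsUELayer P Φ lamU U g) (hlamU : 0 ≤ lamU)
    (hPu : 0 ≤ Pu) (hα : 2 < α) (hs : 0 ≤ s) (hΦ : Measurable (config Φ))
    (hT : Measurable (α := Config) T) (hxR : Measurable xR) {A : Set Plane} (hA : MeasurableSet A) :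
    ∫⁻ ω in (fun ω => T (Φ ω)) ⁻¹' A, ENNReal.ofReal (Real.exp (-(lamU *
        (∫⁻ y in (regularVoronoi (Φ ω) (T (Φ ω)))ᶜ, ENNReal.ofReal
          (gammaFun (s * Pu * ‖y - xR (T (Φ ω))‖ ^ (-α)))).toReal))) ∂P ≤
      ∫⁻ ω in (fun ω => T (Φ ω)) ⁻¹' A, ENNReal.ofReal (Real.exp (-s * interference Pu α
        (regularVoronoi (Φ ω) (T (Φ ω))) (fun n => U n ω) (fun n => g n ω) (xR (T (Φ ω))))) ∂P := by
  have hc : Measurable fun ω => T (Φ ω) := hT.comp hΦ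
  set F : Config × ((ℕ → Plane) × (ℕ → ℝ)) → ℝ≥0∞ := fun q =>
    A.indicator (1 : Plane → ℝ≥0∞) (T q.1) *
    ENNReal.ofReal (Real.exp (-s * interference Pu α (regularVoronoi q.1 (T q.1)) q.2.1 q.2.2
      (xR (T q.1)))) with hF
  have hFm : Measurable F := by
    refine Measurable.mul ?_ ?_
    · exact (measurable_one.indicator hA).comp (hT.comp measurable_fst)
    · exact (Real.measurable_exp.comp
        ((measurable_interference hT hxR Pu α).const_mul (-s))).ennreal_ofReal
  have hright : ∫⁻ ω in (fun ω => T (Φ ω)) ⁻¹' A, ENNReal.ofReal (Real.exp (-s * interference Pu α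
      (regularVoronoi (Φ ω) (T (Φ ω))) (fun n => U n ω) (fun n => g n ω) (xR (T (Φ ω))))) ∂P =
      ∫⁻ ω, F (config Φ ω, layer U g ω) ∂P := by
    rw [← lintegral_indicator (hc hA)]
    refine lintegral_congr fun ω => ?_
    by_cases hω : T (Φ ω) ∈ A
    · have h2 : ω ∈ (fun ω => T (Φ ω)) ⁻¹' A := hω
      rw [Set.indicator_of_mem h2]
      refine Eq.trans ?_ (congrArg (· * _) (Set.indicator_of_mem hω (1 : Plane → ℝ≥0∞))).symm
      exact (one_mul _).symm
    · have h2 : ω ∉ (fun ω => T (Φ ω)) ⁻¹' A := hω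
      rw [Set.indicator_of_notMem h2]
      refine Eq.trans ?_ (congrArg (· * _) (Set.indicator_of_notMem hω (1 : Plane → ℝ≥0∞))).symm
      exact (zero_mul _).symm
  rw [hright, lintegral_indepFun (h.indepFun_config_layer hΦ) hΦ h.measurable_layer hFm,
    ← lintegral_indicator (hc hA)]
  refine lintegral_mono fun ω => ?_
  by_cases hω : T (Φ ω) ∈ A
  · have h2 : ω ∈ (fun ω => T (Φ ω)) ⁻¹' A := hω
    rw [Set.indicator_of_mem h2]
    have hV : MeasurableSet (regularVoronoi (Φ ω) (T (Φ ω))) :=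
      (measurableSet_regularVoronoi hT).preimage (f := fun y => (config Φ ω, y))
        measurable_prodMk_left
    refine (h.exp_le_lintegral_interference hlamU hPu hα hs hV (xR (T (Φ ω)))).trans
      (lintegral_mono fun ω' => ?_)
    refine le_of_eq (Eq.trans ?_
      (congrArg (· * _) (Set.indicator_of_mem hω (1 : Plane → ℝ≥0∞))).symm)
    exact (one_mul _).symm
  · have h2 : ω ∉ (fun ω => T (Φ ω)) ⁻¹' A := hω
    rw [Set.indicator_of_notMem h2]
    exact zero_le

end IsUELayer

/-! ### Jensen's inequality and passage to conditional expectations. -/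

section Jensen

variable {Ω : Type*} [MeasurableSpace Ω] {P : Measure Ω} [IsProbabilityMeasure P]

/-- A form of Jensen's inequality for the exponential function. -/
theorem setLIntegral_exp_le {lam : ℝ} (hlam : 0 ≤ lam) {X Y : Ω → ℝ≥0∞} (hX : Measurable X)
    (hY : Measurable Y) (hXtop : ∀ ω, X ω < ⊤) (hYtop : ∀ ω, Y ω < ⊤) {s : Set Ω}
    (h : ∫⁻ ω in s, ENNReal.ofReal (Real.exp (-(lam * (Y ω).toReal))) * X ω ∂P =
      ∫⁻ ω in s, ENNReal.ofReal (Real.exp (-(lam * (Y ω).toReal))) * Y ω ∂P) :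
    ∫⁻ ω in s, ENNReal.ofReal (Real.exp (-(lam * (Y ω).toReal))) ∂P ≤
      ∫⁻ ω in s, ENNReal.ofReal (Real.exp (-(lam * (X ω).toReal))) ∂P := by
  set κ : Ω → ℝ≥0∞ := fun ω => ENNReal.ofReal (Real.exp (-(lam * (Y ω).toReal))) with hκ
  have hκm : Measurable κ := (Real.measurable_exp.comp
    (hY.ennreal_toReal.const_mul lam).neg).ennreal_ofReal
  -- This is the tangent inequality exp(-a) ≥ exp(-b)(1 + b - a), with the terms arranged so that
  -- nothing is subtracted in `ℝ≥0∞`. By `h`, the terms with X and Y have equal integrals.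
  have hpt : ∀ ω, κ ω + ENNReal.ofReal lam * (κ ω * Y ω) ≤
      ENNReal.ofReal (Real.exp (-(lam * (X ω).toReal))) + ENNReal.ofReal lam * (κ ω * X ω) := by
    intro ω
    set a := lam * (X ω).toReal with ha
    set b := lam * (Y ω).toReal with hb
    have ha0 : 0 ≤ a := by positivity
    have hb0 : 0 ≤ b := by positivity
    have eX : ENNReal.ofReal lam * (κ ω * X ω) = ENNReal.ofReal (Real.exp (-b) * a) := by
      rw [← ENNReal.ofReal_toReal (hXtop ω).ne, hκ, ← ENNReal.ofReal_mul (Real.exp_pos _).le,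
        ← ENNReal.ofReal_mul hlam, ha]
      congr 1
      ring
    have eY : ENNReal.ofReal lam * (κ ω * Y ω) = ENNReal.ofReal (Real.exp (-b) * b) := by
      conv_lhs => rw [← ENNReal.ofReal_toReal (hYtop ω).ne]
      rw [hκ, ← ENNReal.ofReal_mul (Real.exp_pos _).le, ← ENNReal.ofReal_mul hlam, hb]
      congr 1
      ring
    rw [eX, eY, hκ, ← ENNReal.ofReal_add (Real.exp_pos _).le (by positivity),
      ← ENNReal.ofReal_add (Real.exp_pos _).le (by positivity)]
    refine ENNReal.ofReal_le_ofReal ?_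
    have h1 := Real.add_one_le_exp (b - a)
    have h2 : Real.exp (-a) = Real.exp (-b) * Real.exp (b - a) := by
      rw [← Real.exp_add]
      ring_nf
    rw [h2]
    nlinarith [mul_le_mul_of_nonneg_left h1 (Real.exp_pos (-b)).le]
  -- Since b exp(-b) ≤ 1, the common term is finite and can be cancelled.
  have hfin : ∫⁻ ω in s, ENNReal.ofReal lam * (κ ω * Y ω) ∂P ≠ ⊤ := by
    have hle : ∀ ω, ENNReal.ofReal lam * (κ ω * Y ω) ≤ 1 := by
      intro ω
      rw [← ENNReal.ofReal_toReal (hYtop ω).ne, hκ, ← ENNReal.ofReal_mul (Real.exp_pos _).le,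
        ← ENNReal.ofReal_mul hlam, ENNReal.ofReal_le_one]
      have h1 := Real.add_one_le_exp (lam * (Y ω).toReal)
      have h2 : Real.exp (-(lam * (Y ω).toReal)) * Real.exp (lam * (Y ω).toReal) = 1 := by
        rw [← Real.exp_add]
        simp
      nlinarith [mul_le_mul_of_nonneg_left h1 (Real.exp_pos (-(lam * (Y ω).toReal))).le,
        Real.exp_pos (-(lam * (Y ω).toReal))]
    refine ((lintegral_mono hle).trans_lt ?_).ne
    rw [setLIntegral_one]
    exact measure_lt_top _ _
  have hmX : Measurable fun ω => κ ω * X ω := hκm.mul hX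
  have hmY : Measurable fun ω => κ ω * Y ω := hκm.mul hY
  have hm : Measurable fun ω => ENNReal.ofReal lam * (κ ω * X ω) := hmX.const_mul _
  have hmain := lintegral_mono (μ := P.restrict s) hpt
  rw [lintegral_add_left hκm, lintegral_add_right _ hm,
    lintegral_const_mul _ hmX, lintegral_const_mul _ hmY, h] at hmain
  rw [lintegral_const_mul _ hmY] at hfin
  exact (ENNReal.add_le_add_iff_right hfin).1 hmain

end Jensen

/-- Both f and the conditional expectation are m-measurable, so comparing their integrals over the
sets of m suffices once P is trimmed to m. -/
theorem le_condExp_of_setLIntegral_le {Ω : Type*} {m m0 : MeasurableSpace Ω} {P : Measure[m0] Ω}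
    [IsProbabilityMeasure P] (hm : m ≤ m0) {f G : Ω → ℝ} (hf : StronglyMeasurable[m] f)
    (hf0 : ∀ ω, 0 ≤ f ω) (hf1 : ∀ ω, f ω ≤ 1) (hG : AEStronglyMeasurable G P)
    (hG0 : ∀ ω, 0 ≤ G ω) (hG1 : ∀ᵐ ω ∂P, G ω ≤ 1)
    (h : ∀ s, MeasurableSet[m] s →
      ∫⁻ ω in s, ENNReal.ofReal (f ω) ∂P ≤ ∫⁻ ω in s, ENNReal.ofReal (G ω) ∂P) :
    f ≤ᵐ[P] P[G | m] := by
  have hfi : Integrable f P := Integrable.of_bound (hf.mono hm).aestronglyMeasurable 1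
    (ae_of_all _ fun ω => by rw [Real.norm_eq_abs, abs_of_nonneg (hf0 ω)]; exact hf1 ω)
  have hGi : Integrable G P := Integrable.of_bound hG 1
    (hG1.mono fun ω hω => by rwa [Real.norm_eq_abs, abs_of_nonneg (hG0 ω)])
  refine ae_le_of_ae_le_trim (hm := hm) ?_
  refine ae_le_of_forall_setIntegral_le (hfi.trim hm hf)
    (integrable_condExp.trim hm stronglyMeasurable_condExp) fun s hs _ => ?_
  rw [← setIntegral_trim hm hf hs, ← setIntegral_trim hm stronglyMeasurable_condExp hs,
    setIntegral_condExp hm hGi hs,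
    integral_eq_lintegral_of_nonneg_ae (ae_of_all _ hf0) hfi.aestronglyMeasurable.restrict,
    integral_eq_lintegral_of_nonneg_ae (ae_of_all _ hG0) hG.restrict]
  refine ENNReal.toReal_mono ?_ (h s hs)
  exact (hGi.restrict (s := s)).lintegral_lt_top.ne

namespace IsUELayer

variable {Ω : Type*} [MeasurableSpace Ω] {P : Measure Ω} [IsProbabilityMeasure P]
  {Φ : Ω → Set Plane} {lamA lamU : ℝ} {U : ℕ → Ω → Plane} {g : ℕ → Ω → ℝ}
  {T : Set Plane → Plane} {xR : Plane → Plane} {Pu α s : ℝ}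

/-- Jensen's inequality for the exponent of the actual cell and its conditional mean `meanExponent`.
The tangent weight depends only on the centre, so it can be absorbed, together with the indicator of
A, into the test function of `lintegral_voronoi_compl`. -/
theorem setLIntegral_meanExponent_le (hlamA : 0 ≤ lamA) (hlamU : 0 ≤ lamU)
    (hPu : 0 ≤ Pu) (hα : 2 < α) (hs : 0 ≤ s) (hΦ : Measurable (config Φ))
    (hT : Measurable (α := Config) T) (hxR : Measurable xR)
    (hpca : ∀ (x : Plane) (A : Set Plane), MeasurableSet A →
      P ((fun ω => T (Φ ω)) ⁻¹' A ∩ {ω | x ∈ regularVoronoi (Φ ω) (T (Φ ω))}) =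
        ∫⁻ y in A, ENNReal.ofReal (pca lamA x y) ∂(P.map fun ω => T (Φ ω)))
    {A : Set Plane} (hA : MeasurableSet A) :
    ∫⁻ ω in (fun ω => T (Φ ω)) ⁻¹' A, ENNReal.ofReal (Real.exp (-(lamU *
        (meanExponent lamA (s * Pu) α xR (T (Φ ω))).toReal))) ∂P ≤
    ∫⁻ ω in (fun ω => T (Φ ω)) ⁻¹' A, ENNReal.ofReal (Real.exp (-(lamU *
        (∫⁻ y in (regularVoronoi (Φ ω) (T (Φ ω)))ᶜ, ENNReal.ofReal
          (gammaFun (s * Pu * ‖y - xR (T (Φ ω))‖ ^ (-α)))).toReal))) ∂P := by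
  have hc : Measurable fun ω => T (Φ ω) := hT.comp hΦ
  have hτ : 0 ≤ s * Pu := mul_nonneg hs hPu
  have hγm : Measurable fun q : Plane × Plane =>
      ENNReal.ofReal (gammaFun (s * Pu * ‖q.2 - xR q.1‖ ^ (-α))) :=
    (measurable_gammaFun_pathLoss (s * Pu) α hxR).ennreal_ofReal
  have hBm := measurable_meanExponent lamA (s * Pu) α hxR
  have hVω : MeasurableSet {q : Ω × Plane | q.2 ∈ regularVoronoi (Φ q.1) (T (Φ q.1))} :=
    (measurableSet_regularVoronoi hT).preimage (f := fun q : Ω × Plane => (config Φ q.1, q.2))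
      ((hΦ.comp measurable_fst).prodMk measurable_snd)
  have hVs : ∀ ω, MeasurableSet (regularVoronoi (Φ ω) (T (Φ ω))) := fun ω =>
    hVω.preimage (f := fun y => (ω, y)) measurable_prodMk_left
  have hγω : Measurable fun q : Ω × Plane =>
      ENNReal.ofReal (gammaFun (s * Pu * ‖q.2 - xR (T (Φ q.1))‖ ^ (-α))) :=
    Measurable.comp (f := fun q : Ω × Plane => (T (Φ q.1), q.2)) hγm
      ((hc.comp measurable_fst).prodMk measurable_snd)
  have hXm : Measurable fun ω => ∫⁻ y in (regularVoronoi (Φ ω) (T (Φ ω)))ᶜ, ENNReal.ofReal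
      (gammaFun (s * Pu * ‖y - xR (T (Φ ω))‖ ^ (-α))) := by
    have h1 := (hγω.indicator hVω.compl).lintegral_prod_right'
      (ν := (volume : Measure Plane))
    refine Eq.subst (motive := Measurable) (funext fun ω => ?_) h1
    rw [← lintegral_indicator (hVs ω).compl]
    rfl
  refine setLIntegral_exp_le hlamU hXm (hBm.comp hc) (fun ω =>
    (setLIntegral_le_lintegral _ _).trans_lt (lintegral_gammaFun_lt_top hα hτ _))
    (fun ω => meanExponent_lt_top hτ hα xR _) ?_
  set κ : Plane → ℝ≥0∞ := fun c =>
    ENNReal.ofReal (Real.exp (-(lamU * (meanExponent lamA (s * Pu) α xR c).toReal))) with hκ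
  have hκm : Measurable κ := (Real.measurable_exp.comp
    (hBm.ennreal_toReal.const_mul lamU).neg).ennreal_ofReal
  have hφm : Measurable fun q : Plane × Plane => A.indicator κ q.1 *
      ENNReal.ofReal (gammaFun (s * Pu * ‖q.2 - xR q.1‖ ^ (-α))) :=
    ((hκm.indicator hA).comp measurable_fst).mul hγm
  have key := lintegral_voronoi_compl hΦ hT hlamA hpca hφm
  have hγc : ∀ c, Measurable fun y : Plane =>
      ENNReal.ofReal (gammaFun (s * Pu * ‖y - xR c‖ ^ (-α))) := fun c =>
    Measurable.comp (f := fun y : Plane => (c, y)) hγm measurable_prodMk_left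
  have hind : ∀ (Z : Ω → ℝ≥0∞), ∫⁻ ω in (fun ω => T (Φ ω)) ⁻¹' A, κ (T (Φ ω)) * Z ω ∂P =
      ∫⁻ ω, A.indicator κ (T (Φ ω)) * Z ω ∂P := by
    intro Z
    rw [← lintegral_indicator (hc hA)]
    refine lintegral_congr fun ω => ?_
    by_cases hω : T (Φ ω) ∈ A
    · have h2 : ω ∈ (fun ω => T (Φ ω)) ⁻¹' A := hω
      rw [Set.indicator_of_mem h2, Set.indicator_of_mem hω]
    · have h2 : ω ∉ (fun ω => T (Φ ω)) ⁻¹' A := hω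
      rw [Set.indicator_of_notMem h2, Set.indicator_of_notMem hω, zero_mul]
  change ∫⁻ ω in (fun ω => T (Φ ω)) ⁻¹' A, κ (T (Φ ω)) * _ ∂P =
    ∫⁻ ω in (fun ω => T (Φ ω)) ⁻¹' A, κ (T (Φ ω)) * _ ∂P
  rw [hind, hind]
  refine Eq.trans (lintegral_congr fun ω => ?_) (key.trans (lintegral_congr fun ω => ?_))
  · exact (lintegral_const_mul _ (hγc (T (Φ ω)))).symm
  · rw [Function.comp_apply, meanExponent, ← lintegral_const_mul]
    · refine lintegral_congr fun y => ?_
      rw [mul_assoc, ENNReal.ofReal_mul (sub_nonneg.2 (pca_le_one hlamA _ _)), mul_comm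
        (ENNReal.ofReal (gammaFun _))]
    · exact (((measurable_pca_comp lamA measurable_id measurable_const).const_sub 1).mul
        (measurable_gammaFun.comp (by fun_prop))).ennreal_ofReal

/-- The lower bound for the Laplace transform of the interference given the centre `T (Φ ω)` of the
guard region, in integrated form. -/
theorem setLIntegral_radialLaplace_le (h : IsUELayer P Φ lamU U g) (hlamA : 0 ≤ lamA)
    (hlamU : 0 ≤ lamU) (hPu : 0 ≤ Pu) (hα : 2 < α) (hs : 0 ≤ s) (hΦ : Measurable (config Φ))
    (hT : Measurable (α := Config) T) (hxR : Measurable xR) {c : Ω → Plane}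
    (hcT : ∀ᵐ ω ∂P, c ω = T (Φ ω)) (hloc : ∀ᵐ ω ∂P, LocallyFinite (Φ ω))
    (hmem : ∀ᵐ ω ∂P, c ω ∈ Φ ω)
    (hpca : ∀ (x : Plane) (A : Set Plane), MeasurableSet A →
      P (c ⁻¹' A ∩ {ω | x ∈ voronoiCell (Φ ω) (c ω)}) =
        ∫⁻ y in A, ENNReal.ofReal (pca lamA x y) ∂(P.map c)) :
    (∀ᵐ ω ∂P, Summable (interferenceTerm Pu α (voronoiCell (Φ ω) (c ω))
      (fun n => U n ω) (fun n => g n ω) (xR (c ω)))) ∧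
    AEStronglyMeasurable (fun ω => Real.exp (-s * interference Pu α (voronoiCell (Φ ω) (c ω))
      (fun n => U n ω) (fun n => g n ω) (xR (c ω)))) P ∧
    (∀ᵐ ω ∂P, Real.exp (-s * interference Pu α (voronoiCell (Φ ω) (c ω))
      (fun n => U n ω) (fun n => g n ω) (xR (c ω))) ≤ 1) ∧
    ∀ A : Set Plane, MeasurableSet A →
      ∫⁻ ω in c ⁻¹' A, ENNReal.ofReal
        (radialLaplace Pu α (equivDensity lamA lamU (xR (c ω)) (c ω)) s) ∂P ≤
      ∫⁻ ω in c ⁻¹' A, ENNReal.ofReal (Real.exp (-s * interference Pu α (voronoiCell (Φ ω) (c ω))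
        (fun n => U n ω) (fun n => g n ω) (xR (c ω)))) ∂P := by
  have hreg : ∀ᵐ ω ∂P, voronoiCell (Φ ω) (c ω) = regularVoronoi (Φ ω) (T (Φ ω)) := by
    filter_upwards [hcT, hloc, hmem] with ω h1 h2 h3
    rw [← h1]
    exact h2.voronoiCell_eq h3
  have hset : ∀ A : Set Plane, c ⁻¹' A =ᵐ[P] (fun ω => T (Φ ω)) ⁻¹' A := by
    intro A
    filter_upwards [hcT] with ω hω
    change (c ω ∈ A) = (T (Φ ω) ∈ A)
    rw [hω]
  have hexp : (fun ω => Real.exp (-s * interference Pu α (voronoiCell (Φ ω) (c ω))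
      (fun n => U n ω) (fun n => g n ω) (xR (c ω)))) =ᵐ[P] fun ω => Real.exp (-s * interference Pu α
      (regularVoronoi (Φ ω) (T (Φ ω))) (fun n => U n ω) (fun n => g n ω) (xR (T (Φ ω)))) := by
    filter_upwards [hcT, hreg] with ω h1 h2
    rw [h2, h1]
  have hpca' : ∀ (x : Plane) (A : Set Plane), MeasurableSet A →
      P ((fun ω => T (Φ ω)) ⁻¹' A ∩ {ω | x ∈ regularVoronoi (Φ ω) (T (Φ ω))}) =
        ∫⁻ y in A, ENNReal.ofReal (pca lamA x y) ∂(P.map fun ω => T (Φ ω)) := by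
    intro x A hA
    rw [← Measure.map_congr hcT, ← hpca x A hA]
    refine measure_congr ((hset A).symm.inter ?_)
    filter_upwards [hreg] with ω hω
    change (x ∈ regularVoronoi (Φ ω) (T (Φ ω))) = (x ∈ voronoiCell (Φ ω) (c ω))
    rw [hω]
  refine ⟨?_, ?_, ?_, fun A hA => ?_⟩
  · filter_upwards [hcT, h.ae_gain_nonneg, h.ae_tsum_ne_top_of_indep hα hΦ
      (z := fun S => xR (T S)) (hxR.comp hT)] with ω h1 h2 h3
    rw [h1]
    exact summable_interferenceTerm hPu _ h2 h3
  · refine AEStronglyMeasurable.congr ?_ hexp.symm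
    have hm : Measurable fun ω => Real.exp (-s * interference Pu α
        (regularVoronoi (Φ ω) (T (Φ ω))) (fun n => U n ω) (fun n => g n ω) (xR (T (Φ ω)))) :=
      Real.measurable_exp.comp ((Measurable.comp (f := fun ω => (config Φ ω, layer U g ω))
        (measurable_interference hT hxR Pu α) (hΦ.prodMk h.measurable_layer)).const_mul (-s))
    exact hm.aestronglyMeasurable
  · filter_upwards [h.ae_gain_nonneg] with ω hω
    rw [Real.exp_le_one_iff]
    have : 0 ≤ interference Pu α (voronoiCell (Φ ω) (c ω)) (fun n => U n ω) (fun n => g n ω)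
        (xR (c ω)) := tsum_nonneg (interferenceTerm_nonneg hPu hω _)
    nlinarith
  · have e2 : ∫⁻ ω in (fun ω => T (Φ ω)) ⁻¹' A, ENNReal.ofReal (Real.exp (-s * interference Pu α
        (voronoiCell (Φ ω) (c ω)) (fun n => U n ω) (fun n => g n ω) (xR (c ω)))) ∂P =
        ∫⁻ ω in (fun ω => T (Φ ω)) ⁻¹' A, ENNReal.ofReal (Real.exp (-s * interference Pu α
          (regularVoronoi (Φ ω) (T (Φ ω))) (fun n => U n ω) (fun n => g n ω)
          (xR (T (Φ ω))))) ∂P :=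
      lintegral_congr_ae (ae_restrict_of_ae (hexp.mono fun ω hω => congrArg ENNReal.ofReal hω))
    rw [Measure.restrict_congr_set (hset A), e2]
    -- Two bounds are chained: Jensen over the APs given the centre, then the Laplace bound over the
    -- UEs with the APs frozen.
    refine le_trans (le_of_eq ?_) ((setLIntegral_meanExponent_le hlamA hlamU hPu hα hs hΦ hT hxR
      hpca' hA).trans (h.setLIntegral_exp_guard_le hlamU hPu hα hs hΦ hT hxR hA))
    refine lintegral_congr_ae (ae_restrict_of_ae (hcT.mono fun ω hω => ?_))
    change ENNReal.ofReal (radialLaplace Pu α (equivDensity lamA lamU (xR (c ω)) (c ω)) s) = _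
    rw [hω, radialLaplace_eq hlamA lamU hPu hs]
    rfl

end IsUELayer

theorem radialLaplace_mem_Icc {lamA lamU : ℝ} (hlamA : 0 ≤ lamA) (hlamU : 0 ≤ lamU) {Pw α s : ℝ}
    (hPw : 0 ≤ Pw) (hs : 0 ≤ s) (z c : Plane) :
    radialLaplace Pw α (equivDensity lamA lamU z c) s ∈ Set.Icc 0 1 := by
  rw [radialLaplace_eq hlamA lamU hPw hs]
  refine ⟨(Real.exp_pos _).le, Real.exp_le_one_iff.2 (neg_nonpos.2 ?_)⟩
  positivity

namespace IsHPPP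

variable {Ω : Type*} [MeasurableSpace Ω] {P : Measure Ω} {lam : ℝ} {Φ : Ω → Set Plane}

/-- The conditional cell area function is given by `pca`. -/
theorem condExp_voronoi [IsProbabilityMeasure P] (h : IsHPPP P lam Φ) (hlam : 0 < lam)
    {c : Ω → Plane} (hc : Measurable c) (hcN : ∀ᵐ ω ∂P, IsNearest (Φ ω) (c ω)) (x : Plane) :
    P[{ω | x ∈ voronoiCell (Φ ω) (c ω)}.indicator (fun _ => (1 : ℝ)) |
        MeasurableSpace.comap c inferInstance] =ᵐ[P] fun ω => pca lam x (c ω) := by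
  have hV := h.nullMeasurableSet_voronoi hlam hcN x
  have hpm : Measurable fun y => pca lam x y :=
    measurable_pca_comp lam measurable_const measurable_id
  have hpi : Integrable (fun ω => pca lam x (c ω)) P := by
    refine Integrable.of_bound (hpm.comp hc).aestronglyMeasurable 1 (ae_of_all _ fun ω => ?_)
    rw [Real.norm_eq_abs, abs_of_pos (pca_pos _ _ _)]
    exact pca_le_one hlam.le _ _
  refine (ae_eq_condExp_of_forall_setIntegral_eq hc.comap_le
    ((integrable_const (1 : ℝ)).indicator₀ hV) (fun s _ _ => hpi.integrableOn) ?_ ?_).symm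
  · rintro s ⟨A, hA, rfl⟩ -
    rw [integral_indicator₀ (hV.mono_ac Measure.restrict_le_self.absolutelyContinuous),
      Measure.restrict_restrict₀ (hV.mono_ac Measure.restrict_le_self.absolutelyContinuous),
      setIntegral_const, smul_eq_mul, mul_one, measureReal_def, Set.inter_comm,
      h.measure_voronoi hlam hc hcN x hA, setLIntegral_map hA hpm.ennreal_ofReal hc,
      integral_eq_lintegral_of_nonneg_ae (ae_of_all _ fun ω => (pca_pos _ _ _).le)
        (hpm.comp hc).aestronglyMeasurable]
  · exact (hpm.stronglyMeasurable.comp_measurable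
      (comap_measurable c)).aestronglyMeasurable

end IsHPPP

end CellularInterference
end

/-! ### The main theorem. -/

open CellularInterference in
theorem proposition2 {Ω : Type*} [MeasurableSpace Ω] (P : Measure Ω) [IsProbabilityMeasure P]
    (lamA lamU Pu α : ℝ) (hlamA : 0 < lamA) (hlamU : 0 < lamU) (hPu : 0 < Pu) (hα : 2 < α)
    (Φa : Ω → Set Plane) (hΦa : IsHPPP P lamA Φa) :
    -- the typical node is a UE: condition on the position `xstar` of the AP nearest to the origin;
    -- the receiver position is any function `xR` of `xstar`, for example a constant
    (∀ (U : ℕ → Ω → Plane) (g : ℕ → Ω → ℝ), IsUELayer P Φa lamU U g →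
      ∀ xstar : Ω → Plane, Measurable xstar → (∀ᵐ ω ∂P, IsNearest (Φa ω) (xstar ω)) →
        (∀ x : Plane,
          P[{ω | x ∈ voronoiCell (Φa ω) (xstar ω)}.indicator (fun _ => (1 : ℝ)) |
              MeasurableSpace.comap xstar inferInstance]
            =ᵐ[P] fun ω => pca lamA x (xstar ω)) ∧
        ∀ xR : Plane → Plane, Measurable xR →
          (∀ᵐ ω ∂P, Summable (interferenceTerm Pu α (voronoiCell (Φa ω) (xstar ω))
            (fun n => U n ω) (fun n => g n ω) (xR (xstar ω)))) ∧
          ∀ s : ℝ, 0 ≤ s →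
            ∀ᵐ ω ∂P,
              radialLaplace Pu α (equivDensity lamA lamU (xR (xstar ω)) (xstar ω)) s ≤
                (P[fun ω' => Real.exp (-s * interference Pu α
                    (voronoiCell (Φa ω') (xstar ω')) (fun n => U n ω') (fun n => g n ω')
                    (xR (xstar ω'))) |
                  MeasurableSpace.comap xstar inferInstance]) ω) ∧
    -- the typical node is an AP: condition on an AP at the origin, so that `xstar = o`
    (∀ (Ω₀ : Type*) [MeasurableSpace Ω₀] (P₀ : Measure Ω₀) [IsProbabilityMeasure P₀]
      (Φ₀ : Ω₀ → Set Plane), HasPalmLaw P lamA Φa P₀ Φ₀ →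
      ∀ (U : ℕ → Ω₀ → Plane) (g : ℕ → Ω₀ → ℝ), IsUELayer P₀ Φ₀ lamU U g →
        (∀ x : Plane, P₀.real {ω | x ∈ voronoiCell (Φ₀ ω) 0} = pca lamA x 0) ∧
        ∀ xR : Plane,
          (∀ᵐ ω ∂P₀, Summable (interferenceTerm Pu α (voronoiCell (Φ₀ ω) 0)
            (fun n => U n ω) (fun n => g n ω) xR)) ∧
          ∀ s : ℝ, 0 ≤ s →
            radialLaplace Pu α (equivDensity lamA lamU xR 0) s ≤
              ∫ ω, Real.exp (-s * interference Pu α (voronoiCell (Φ₀ ω) 0)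
                (fun n => U n ω) (fun n => g n ω) xR) ∂P₀) := by
  have hΦ : Measurable (config Φa) := measurable_config hΦa.measurable_count
  refine ⟨fun U g hU xstar hc hcN => ⟨hΦa.condExp_voronoi hlamA hc hcN, fun xR hxR => ?_⟩, ?_⟩
  -- The independence argument needs the centre to be a measurable function of the configuration;
  -- `xstar` is one almost surely, by uniqueness of the nearest point.
  · have hcT : ∀ᵐ ω ∂P, xstar ω = nearestPoint (Φa ω) := by
      filter_upwards [hcN, hΦa.ae_exists_ball_eq_singleton hlamA] with ω h1 ⟨p, q, h2⟩
      rw [nearestPoint_eq h2]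
      exact (h1.eq_of_ball h2).1
    have key : ∀ s : ℝ, 0 ≤ s → _ := fun s hs =>
      hU.setLIntegral_radialLaplace_le hlamA.le hlamU.le hPu.le hα hs hΦ measurable_nearestPoint hxR
        hcT hΦa.ae_locallyFinite (hcN.mono fun ω hω => hω.1)
        (fun x A hA => hΦa.measure_voronoi hlamA hc hcN x hA)
    refine ⟨(key 0 le_rfl).1, fun s hs => ?_⟩
    obtain ⟨-, hm, hle, hint⟩ := key s hs
    refine le_condExp_of_setLIntegral_le hc.comap_le
      (f := fun ω => radialLaplace Pu α (equivDensity lamA lamU (xR (xstar ω)) (xstar ω)) s)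
      ((measurable_radialLaplace hlamA.le lamU hPu.le hs hxR).stronglyMeasurable.comp_measurable
        (comap_measurable xstar))
      (fun ω => (radialLaplace_mem_Icc hlamA.le hlamU.le hPu.le hs _ _).1)
      (fun ω => (radialLaplace_mem_Icc hlamA.le hlamU.le hPu.le hs _ _).2) hm
      (fun ω => (Real.exp_pos _).le) hle ?_
    rintro t ⟨A, hA, rfl⟩
    exact hint A hA
  · intro Ω₀ _ P₀ _ Φ₀ hPalm U g hU
    have hV := hPalm.measure_voronoi hΦa hlamA
    refine ⟨fun x => by rw [measureReal_def, hV, ENNReal.toReal_ofReal (pca_pos _ _ _).le],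
      fun xR => ?_⟩
    -- In the Palm case the centre is the constant 0, so its law is a point mass and conditioning on
    -- it is trivial.
    have hpca : ∀ (x : Plane) (A : Set Plane), MeasurableSet A →
        P₀ ((fun _ => (0 : Plane)) ⁻¹' A ∩ {ω | x ∈ voronoiCell (Φ₀ ω) 0}) =
          ∫⁻ y in A, ENNReal.ofReal (pca lamA x y) ∂(P₀.map fun _ => (0 : Plane)) := by
      intro x A hA
      have hpm : Measurable fun y => ENNReal.ofReal (pca lamA x y) :=
        (measurable_pca_comp lamA measurable_const measurable_id).ennreal_ofReal
      rw [setLIntegral_map hA hpm measurable_const, setLIntegral_const]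
      by_cases h0 : (0 : Plane) ∈ A
      · rw [Set.preimage_const_of_mem h0, Set.univ_inter, hV, measure_univ, mul_one]
      · rw [Set.preimage_const_of_notMem h0, Set.empty_inter, measure_empty, mul_zero]
    have key : ∀ s : ℝ, 0 ≤ s → _ := fun s hs =>
      hU.setLIntegral_radialLaplace_le hlamA.le hlamU.le hPu.le hα hs
        (show Measurable (config Φ₀) from hPalm.measurable) (T := fun _ => 0) measurable_const
        (measurable_const : Measurable fun _ : Plane => xR) (ae_of_all P₀ fun _ => rfl)
        (hPalm.ae_locallyFinite hΦa hlamA) (hPalm.ae_zero_mem hΦa hlamA) hpca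
    refine ⟨(key 0 le_rfl).1, fun s hs => ?_⟩
    obtain ⟨-, hm, hle, hint⟩ := key s hs
    have h1 := hint Set.univ MeasurableSet.univ
    rw [Set.preimage_univ, Measure.restrict_univ, lintegral_const, measure_univ, mul_one] at h1
    rw [integral_eq_lintegral_of_nonneg_ae (ae_of_all _ fun ω => (Real.exp_pos _).le) hm]
    refine (ENNReal.ofReal_le_iff_le_toReal ?_).1 h1
    refine ((lintegral_mono_ae (hle.mono fun ω hω => ENNReal.ofReal_le_one.2 hω)).trans_lt ?_).ne
    rw [lintegral_one]
    exact measure_lt_top _ _
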